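/- For an integer $n\ge 0$ and $K=\mathbb R$ or $K=\mathbb C$, let the resonance arrangement $\mathcal A_n$ be the set of all hyperplanes $\{x\in K^n : \sum_{i\in I}x_i=0\}$ with $I$ a nonempty subset of $\{1,\dots,n\}$. Let $$\chi(\mathcal A_n;t)=\sum_{T\subseteq\mathcal A_n}(-1)^{|T|}\,t^{\,r(\mathcal A_n)-r(T)}$$ be its characteristic polynomial, where $r(T)$ is the codimension of the intersection of the hyperplanes in $T$ (so $r(\emptyset)=0$ and $r(\mathcal A_n)=n$). Let $b_4(\mathcal A_n)$ denote the coefficient of $t^{n-4}$ in $\chi(\mathcal A_n;t)$, which is $0$ if $n<4$. Then for all $n\ge 0$, $$b_4(\mathcal A_n)=\tfrac1{48}\bigl(2\cdot16^n-18\cdot12^n+31\cdot10^n+33\cdot9^n-119\cdot8^n+77\cdot7^n+77\cdot6^n-173\cdot5^n+155\cdot4^n-113\cdot3^n+64\cdot2^n-16\bigr).$$ -/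

import Mathlib

open Polynomial

/-- The rank of a family `T` of linear hyperplanes (or subspaces) of `V`: the codimension in `V`
of the intersection of its members (the empty intersection is `V`). -/
noncomputable def arrangementRank {K V : Type*} [Field K] [AddCommGroup V] [Module K V]
    (T : Finset (Submodule K V)) : ℕ :=
  Module.finrank K (V ⧸ T.inf id)

/-- The characteristic polynomial `∑_{T ⊆ A} (-1)^|T| t^(r(A) - r(T))` of a finite central
arrangement `A`. In a finite-dimensional space `r(T) ≤ r(A)` for `T ⊆ A`, so that the
subtraction of exponents is a true one. -/
noncomputable def arrangementCharPoly {K V : Type*} [Field K] [AddCommGroup V] [Module K V]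
    (A : Finset (Submodule K V)) : ℤ[X] :=
  ∑ T ∈ A.powerset, (-1) ^ T.card * X ^ (arrangementRank A - arrangementRank T)

/-- The subspace `{x | ∑_{i ∈ I} x_i = 0}` of `Kⁿ`. -/
def resonanceHyperplane (K : Type*) [Field K] (n : ℕ) (I : Finset (Fin n)) :
    Submodule K (Fin n → K) where
  carrier := {x | ∑ i ∈ I, x i = 0}
  add_mem' := by
    intro x y hx hy
    simp only [Set.mem_ofPred_eq] at hx hy ⊢
    simp [Finset.sum_add_distrib, hx, hy]
  zero_mem' := by simp
  smul_mem' := by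
    intro c x hx
    simp only [Set.mem_ofPred_eq] at hx ⊢
    simp [← Finset.mul_sum, hx]

open Classical in
/-- The resonance arrangement in `Kⁿ`: all hyperplanes `∑_{i ∈ I} x_i = 0` with `I` a nonempty
subset of the index set. -/
noncomputable def resonanceArrangement (K : Type*) [Field K] (n : ℕ) :
    Finset (Submodule K (Fin n → K)) :=
  ((Finset.univ : Finset (Finset (Fin n))).filter (fun I => I.Nonempty)).image
    (resonanceHyperplane K n)

/-- The coefficient of `t^(n-i)` in the characteristic polynomial of the resonance arrangement in
`Kⁿ`. For `i > n` the exponent is negative and the coefficient is `0`.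
For even `i` this is the `i`-th Betti number of the complement of the arrangement in `ℂⁿ` (for odd
`i` the coefficient is minus that number). -/
noncomputable def resonanceBetti (K : Type*) [Field K] (n i : ℕ) : ℤ :=
  if i ≤ n then (arrangementCharPoly (resonanceArrangement K n)).coeff (n - i) else 0

/-! The coefficient of `t^(n-4)` is the sum of `(-1)^|S|` over the families `S` of nonempty subsets
of an `n`-set whose hyperplanes meet in codimension 4, and this codimension is the rank of the 0/1
incidence matrix of `S`.

An `m × n` incidence matrix is read by columns, as a word of length `n` in the alphabet `{0,1}^m`.
Whether its rows are distinct and nonzero depends only on the span of the columns. Reading the word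
from its end and keeping each letter that is not in the span of the later ones leaves a basis of `r`
letters; every other letter is a free choice among the `d_j` zero-one vectors in the span of the
last `j` basis letters, where `j` basis letters have been met. Hence the words with a given basis
number `h_{n-r}(d_0, …, d_r)`, a complete homogeneous sum (`sum_words_eq_sum_bases`). The basis
letters are the columns of a rank `r` family on an `r`-set, and `d_j` counts the linear forms in the
last `j` coordinates with values 0 and 1 on its members. So the sum over families on an `n`-set
becomes a sum over spanning families on an `r`-set, in which `n` occurs only inside `h`
(`sum_families_eq_sum_spanning_families`).

For `r = 4` this is a finite computation with the 15 nonzero vectors of `{0,1}^4`. A spanning set is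
`B ∪ U`, where `B` is its greedy basis and `U` is any set of vectors each in the span of the earlier
members of `B` (`sum_spanning_eq_sum_leadingBasis`). A form with values 0 and 1 on `B` is given by
these four values, a number `z < 16`, and each `u` in `U` cuts down the set of admissible `z`. The
alternating sum over `U` is a recursion on such sets (`evalTally_subsetTally`), and the outcome is a
table of multiplicities of the quadruples `(d_1, …, d_4)` (`spanningTally_eq`). There `1 = d_0 < d_1
< … < d_4`, so divided differences turn each `h` into a combination of the powers `d_i^n`
(`homogeneousSum_four_eq`), and these add up to the closed form. -/

/-! ### The coefficient as a signed count of families of sets. -/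

/-- The indicator vector of a finite set. -/
def indicatorVec (K : Type*) [Field K] {ι : Type*} [DecidableEq ι] (a : Finset ι) : ι → K :=
  fun i => if i ∈ a then 1 else 0

/-- The incidence matrix of a family of finite sets. -/
def incidenceMatrix (K : Type*) [Field K] {ι κ : Type*} [DecidableEq κ] (x : ι → Finset κ) :
    Matrix ι κ K :=
  Matrix.of fun i => indicatorVec K (x i)

theorem mem_resonanceHyperplane {K : Type*} [Field K] {n : ℕ} {I : Finset (Fin n)}
    {x : Fin n → K} : x ∈ resonanceHyperplane K n I ↔ ∑ i ∈ I, x i = 0 := Iff.rfl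

theorem resonanceHyperplane_injective (K : Type*) [Field K] (n : ℕ) :
    Function.Injective (resonanceHyperplane K n) := by
  intro I J h
  ext i
  have key : ∀ S : Finset (Fin n), Pi.single i (1 : K) ∈ resonanceHyperplane K n S ↔ i ∉ S := by
    intro S
    rw [mem_resonanceHyperplane]
    simp [Pi.single_apply]
  have := key I
  rw [h, key J] at this
  exact (not_iff_not.1 this).symm

/-- The intersection is the kernel of the incidence matrix, and the quotient by the kernel is
isomorphic to the range. -/
theorem finrank_quotient_iInf_resonanceHyperplane {K : Type*} [Field K] {n : ℕ} {ι : Type*}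
    [Fintype ι] (x : ι → Finset (Fin n)) :
    Module.finrank K ((Fin n → K) ⧸ ⨅ i, resonanceHyperplane K n (x i)) =
      (incidenceMatrix K x).rank := by
  have hker : (⨅ i, resonanceHyperplane K n (x i)) =
      LinearMap.ker (incidenceMatrix K x).mulVecLin := by
    ext v
    simp only [Submodule.mem_iInf, mem_resonanceHyperplane, LinearMap.mem_ker,
      Matrix.mulVecLin_apply, funext_iff, Matrix.mulVec, dotProduct, incidenceMatrix,
      Matrix.of_apply, indicatorVec]
    simp
  rw [hker, Matrix.rank]
  exact (incidenceMatrix K x).mulVecLin.quotKerEquivRange.finrank_eq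

/-- The codimension of the intersection of the hyperplanes with index sets in `S`. -/
noncomputable def familyRank (K : Type*) [Field K] {n : ℕ} (S : Finset (Finset (Fin n))) : ℕ :=
  Module.finrank K ((Fin n → K) ⧸ S.inf (resonanceHyperplane K n))

theorem familyRank_image {K : Type*} [Field K] {n : ℕ} {ι : Type*} [Fintype ι]
    (x : ι → Finset (Fin n)) :
    familyRank K (Finset.univ.image x) = (incidenceMatrix K x).rank := by
  rw [familyRank, ← finrank_quotient_iInf_resonanceHyperplane, Finset.inf_image,
    Finset.inf_univ_eq_iInf]
  rfl

theorem familyRank_le {K : Type*} [Field K] {n : ℕ} (S : Finset (Finset (Fin n))) :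
    familyRank K S ≤ n := by
  simpa [familyRank] using (S.inf (resonanceHyperplane K n)).finrank_quotient_le

theorem resonanceArrangement_inf (K : Type*) [Field K] (n : ℕ) :
    (resonanceArrangement K n).inf id = ⊥ := by
  rw [eq_bot_iff]
  intro x hx
  rw [Submodule.mem_bot]
  funext i
  have : (resonanceArrangement K n).inf id ≤ resonanceHyperplane K n {i} := by
    refine Finset.inf_le (f := id) ?_
    simp only [resonanceArrangement, Finset.mem_image]
    exact ⟨{i}, by simp, rfl⟩
  simpa [mem_resonanceHyperplane] using this hx

theorem arrangementRank_resonanceArrangement (K : Type*) [Field K] (n : ℕ) :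
    arrangementRank (resonanceArrangement K n) = n := by
  rw [arrangementRank, resonanceArrangement_inf]
  simpa using ((Submodule.quotEquivOfEqBot (⊥ : Submodule K (Fin n → K)) rfl).finrank_eq)

open Classical in
theorem resonanceBetti_eq_sum (K : Type*) [Field K] (n i : ℕ) :
    resonanceBetti K n i =
      ∑ S : Finset (Finset (Fin n)),
        if (∀ I ∈ S, I.Nonempty) ∧ familyRank K S = i then (-1 : ℤ) ^ S.card else 0 := by
  have hchar : arrangementCharPoly (resonanceArrangement K n) =
      ∑ S ∈ ((Finset.univ : Finset (Finset (Fin n))).filter (fun I => I.Nonempty)).powerset,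
        (-1 : ℤ[X]) ^ S.card * X ^ (n - familyRank K S) := by
    rw [arrangementCharPoly, arrangementRank_resonanceArrangement]
    symm
    refine Finset.sum_bij (fun S _ => S.image (resonanceHyperplane K n)) ?_ ?_ ?_ ?_
    · intro S hS
      rw [Finset.mem_powerset] at hS ⊢
      exact Finset.image_subset_image hS
    · intro S _ S' _ h
      exact Finset.image_injective (resonanceHyperplane_injective K n) h
    · intro T hT
      rw [Finset.mem_powerset, resonanceArrangement, Finset.subset_image_iff] at hT
      obtain ⟨S, hS, rfl⟩ := hT
      exact ⟨S, by simpa using hS, rfl⟩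
    · intro S _
      rw [Finset.card_image_of_injective _ (resonanceHyperplane_injective K n), familyRank,
        arrangementRank, Finset.inf_image]
      rfl
  have hfilter : ∀ S : Finset (Finset (Fin n)),
      S ∈ ((Finset.univ : Finset (Finset (Fin n))).filter (fun I => I.Nonempty)).powerset ↔
        ∀ I ∈ S, I.Nonempty := by
    intro S
    simp [Finset.subset_iff]
  rw [resonanceBetti]
  split_ifs with hi
  · rw [hchar, finsetSum_coeff, ← Finset.sum_filter_add_sum_filter_not Finset.univ
      (fun S : Finset (Finset (Fin n)) => ∀ I ∈ S, I.Nonempty)]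
    rw [Finset.sum_eq_zero (s := Finset.univ.filter
      fun S : Finset (Finset (Fin n)) => ¬ ∀ I ∈ S, I.Nonempty), add_zero]
    · refine Finset.sum_congr ?_ ?_
      · ext S
        rw [hfilter]
        simp
      · intro S hS
        have h1 : ∀ I ∈ S, I.Nonempty := by simpa using hS
        have h2 := familyRank_le (K := K) S
        have h3 : ((-1 : ℤ[X]) ^ S.card) = C ((-1 : ℤ) ^ S.card) := by simp
        rw [h3, coeff_C_mul, coeff_X_pow]
        -- Both `i` and the rank are at most `n`, so the truncated differences are true ones.
        have h4 : n - i = n - familyRank K S ↔ familyRank K S = i := by omega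
        by_cases h5 : familyRank K S = i
        · rw [if_pos (h4.2 h5), if_pos ⟨h1, h5⟩, mul_one]
        · rw [if_neg (fun h => h5 (h4.1 h)), if_neg (fun h => h5 h.2), mul_zero]
    · intro S hS
      rw [if_neg]
      intro h
      exact (Finset.mem_filter.1 hS).2 h.1
  -- For `i > n` no family has rank `i`, so the sum is zero as well.
  · symm
    refine Finset.sum_eq_zero fun S _ => if_neg fun h => ?_
    have := familyRank_le (K := K) S
    omega

/-! ### Words counted by their bases of latest letters. -/

/-- `homogeneousSum d n r` is the complete homogeneous symmetric polynomial of degree `n - r` in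
`d 0, …, d r` (and `0` if `n < r`). -/
def homogeneousSum {R : Type*} [CommRing R] (d : ℕ → R) : ℕ → ℕ → R
  | 0, 0 => 1
  | 0, _ + 1 => 0
  | n + 1, 0 => d 0 * homogeneousSum d n 0
  | n + 1, r + 1 => d (r + 1) * homogeneousSum d n (r + 1) + homogeneousSum d n r

theorem homogeneousSum_congr {R : Type*} [CommRing R] {d e : ℕ → R} (n r : ℕ)
    (h : ∀ j ≤ r, d j = e j) : homogeneousSum d n r = homogeneousSum e n r := by
  induction n generalizing r with
  | zero => cases r <;> rfl
  | succ n ih =>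
    cases r with
    | zero => rw [homogeneousSum, homogeneousSum, h 0 le_rfl, ih 0 h]
    | succ r =>
      rw [homogeneousSum, homogeneousSum, h _ le_rfl, ih (r + 1) h,
        ih r fun j hj => h j (hj.trans r.le_succ)]

section Words

variable {K V α : Type*} [Field K] [AddCommGroup V] [Module K V]

open Classical in
/-- The number of letters with value in the span of the last `j` members of `b`. -/
noncomputable def tailCount (K : Type*) {V α : Type*} [Field K] [AddCommGroup V] [Module K V]
    [Fintype α] (f : α → V) {r : ℕ} (b : Fin r → α) (j : ℕ) : ℤ :=
  (Finset.univ.filter fun a => f a ∈ Submodule.span K ((fun i => f (b i)) '' {i | r ≤ i + j})).card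

theorem tailCount_cons [Fintype α] (f : α → V) {r : ℕ} (a : α) (b : Fin r → α) {j : ℕ}
    (hj : j ≤ r) :
    tailCount K f (Fin.cons a b : Fin (r + 1) → α) j = tailCount K f b j := by
  have : ((fun i => f ((Fin.cons a b : Fin (r + 1) → α) i)) '' {i | r + 1 ≤ i + j}) =
      (fun i => f (b i)) '' {i | r ≤ i + j} := by
    ext v
    simp only [Set.mem_image, Set.mem_ofPred_eq, Fin.exists_fin_succ, Fin.val_zero, Fin.cons_zero,
      Fin.val_succ, Fin.cons_succ]
    constructor
    · rintro (⟨h, -⟩ | ⟨i, h, rfl⟩)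
      · omega
      · exact ⟨i, by omega, rfl⟩
    · rintro ⟨i, h, rfl⟩
      exact Or.inr ⟨i, by omega, rfl⟩
  rw [tailCount, this, tailCount]

open Classical in
theorem tailCount_self [Fintype α] (f : α → V) {r : ℕ} (b : Fin r → α) :
    tailCount K f b r =
      (Finset.univ.filter fun a => f a ∈ Submodule.span K (Set.range fun i => f (b i))).card := by
  have : {i : Fin r | r ≤ i + r} = Set.univ := by ext i; simp
  rw [tailCount, this, Set.image_univ]

theorem span_range_cons (f : α → V) {r : ℕ} (a : α) (b : Fin r → α) :
    Submodule.span K (Set.range fun i => f ((Fin.cons a b : Fin (r + 1) → α) i)) =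
      Submodule.span K {f a} ⊔ Submodule.span K (Set.range fun i => f (b i)) := by
  rw [← Submodule.span_union]
  congr 1
  ext v
  simp [Fin.exists_fin_succ, eq_comm]

theorem finrank_span_singleton_sup [FiniteDimensional K V] {W : Submodule K V} {v : V}
    (hv : v ∉ W) :
    Module.finrank K ↥(Submodule.span K {v} ⊔ W) = Module.finrank K W + 1 := by
  have hv0 : v ≠ 0 := fun h => hv (h ▸ W.zero_mem)
  have h := Submodule.finrank_sup_add_finrank_inf_eq (Submodule.span K {v}) W
  rw [finrank_span_singleton hv0, (Submodule.disjoint_span_singleton' hv0).2 hv |>.symm.eq_bot] at h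
  simp at h
  omega

open Classical in
/-- Sorting words by their bases of latest letters: a word is determined by the places of the
letters that are not in the span of the later ones, by those letters, and by the choice of all
others in the span that was reached before. -/
theorem sum_words_eq_sum_bases [FiniteDimensional K V] [Fintype α] (f : α → V) (n r : ℕ)
    (F : Submodule K V → ℤ) :
    (∑ g : Fin n → α,
      if Module.finrank K (Submodule.span K (Set.range fun k => f (g k))) = r then
        F (Submodule.span K (Set.range fun k => f (g k))) else 0) =
    ∑ b : Fin r → α,
      if LinearIndependent K (fun i => f (b i)) then
        F (Submodule.span K (Set.range fun i => f (b i))) *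
          homogeneousSum (tailCount K f b) n r else 0 := by
  induction n generalizing r F with
  | zero =>
    cases r with
    | zero => simp [homogeneousSum]
    | succ r =>
      have h0 : ∀ g : Fin 0 → α, Set.range (fun k => f (g k)) = ∅ := fun g => Set.range_eq_empty _
      simp only [homogeneousSum, mul_zero, ite_self, Finset.sum_const_zero]
      refine Finset.sum_eq_zero fun g _ => if_neg ?_
      rw [h0, Submodule.span_empty, finrank_bot]
      omega
  | succ n ih =>
    rw [← (Fin.consEquiv fun _ : Fin (n + 1) => α).sum_comp, Fintype.sum_prod_type_right]
    -- A new first letter either lies in the span `W` of the others or raises the dimension by one.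
    -- `F` is arbitrary in the induction because each case replaces it by another function of `W`.
    have hsplit : ∀ (g : Fin n → α),
        (∑ a : α, if Module.finrank K (Submodule.span K (Set.range fun k =>
            f ((Fin.cons a g : Fin (n + 1) → α) k))) = r then
            F (Submodule.span K (Set.range fun k => f ((Fin.cons a g : Fin (n + 1) → α) k)))
            else 0) =
        (if Module.finrank K (Submodule.span K (Set.range fun k => f (g k))) = r then
          (fun W => F W * ((Finset.univ.filter fun a => f a ∈ W).card : ℤ))
            (Submodule.span K (Set.range fun k => f (g k))) else 0) +
        (if Module.finrank K (Submodule.span K (Set.range fun k => f (g k))) + 1 = r then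
          (fun W => ∑ a : α, if f a ∈ W then 0 else F (Submodule.span K {f a} ⊔ W))
            (Submodule.span K (Set.range fun k => f (g k))) else 0) := by
      intro g
      set W := Submodule.span K (Set.range fun k => f (g k)) with hW
      have h1 : ∀ a : α, (if Module.finrank K (Submodule.span K (Set.range fun k =>
            f ((Fin.cons a g : Fin (n + 1) → α) k))) = r then
            F (Submodule.span K (Set.range fun k => f ((Fin.cons a g : Fin (n + 1) → α) k)))
            else 0) =
          (if f a ∈ W then (if Module.finrank K W = r then F W else 0) else 0) +
          (if Module.finrank K W + 1 = r then
            (if f a ∈ W then 0 else F (Submodule.span K {f a} ⊔ W)) else 0) := by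
        intro a
        rw [span_range_cons, ← hW]
        by_cases ha : f a ∈ W
        · have : Submodule.span K {f a} ⊔ W = W :=
            sup_eq_right.2 ((Submodule.span_singleton_le_iff_mem _ _).2 ha)
          rw [this, if_pos ha, if_pos ha, ite_self, add_zero]
        · rw [finrank_span_singleton_sup ha]
          simp [ha]
      rw [Finset.sum_congr rfl fun a _ => h1 a, Finset.sum_add_distrib]
      congr 1
      · rw [← Finset.sum_filter, Finset.sum_const, nsmul_eq_mul]
        split_ifs <;> ring
      · split_ifs <;> simp
    have hsum := Finset.sum_congr (rfl : (Finset.univ : Finset (Fin n → α)) = Finset.univ)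
      fun g _ => hsplit g
    refine hsum.trans ?_
    rw [Finset.sum_add_distrib]
    beta_reduce
    rw [ih r (fun W => F W * ((Finset.univ.filter fun a => f a ∈ W).card : ℤ))]
    cases r with
    | zero =>
      simp only [Nat.add_eq_zero_iff, one_ne_zero, and_false, if_false, Finset.sum_const_zero,
        add_zero]
      refine Finset.sum_congr rfl fun b _ => ?_
      rw [homogeneousSum, tailCount_self]
      split_ifs <;> ring
    | succ r =>
      simp only [Nat.add_right_cancel_iff]
      rw [ih r (fun W => ∑ a : α, if f a ∈ W then 0 else F (Submodule.span K {f a} ⊔ W))]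
      -- The two terms of the recursion for `homogeneousSum` match the two cases: a first letter
      -- inside the span has `d (r + 1)` choices, and one outside it becomes the first basis letter.
      have hrec : ∀ b : Fin (r + 1) → α, (if LinearIndependent K (fun i => f (b i)) then
          F (Submodule.span K (Set.range fun i => f (b i))) *
            homogeneousSum (tailCount K f b) (n + 1) (r + 1) else 0) =
          (if LinearIndependent K (fun i => f (b i)) then
          (F (Submodule.span K (Set.range fun i => f (b i))) *
            ((Finset.univ.filter fun a => f a ∈
              Submodule.span K (Set.range fun i => f (b i))).card : ℤ)) *
            homogeneousSum (tailCount K f b) n (r + 1) else 0) +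
          (if LinearIndependent K (fun i => f (b i)) then
          F (Submodule.span K (Set.range fun i => f (b i))) *
            homogeneousSum (tailCount K f b) n r else 0) := by
        intro b
        rw [homogeneousSum, tailCount_self]
        split_ifs <;> ring
      rw [Finset.sum_congr rfl fun b _ => hrec b, Finset.sum_add_distrib]
      congr 1
      rw [← (Fin.consEquiv fun _ : Fin (r + 1) => α).sum_comp, Fintype.sum_prod_type_right]
      refine Finset.sum_congr rfl fun b _ => ?_
      have hli : ∀ a : α, LinearIndependent K
          (fun i => f ((Fin.cons a b : Fin (r + 1) → α) i)) ↔
          LinearIndependent K (fun i => f (b i)) ∧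
            f a ∉ Submodule.span K (Set.range fun i => f (b i)) := by
        intro a
        have : (fun i => f ((Fin.cons a b : Fin (r + 1) → α) i)) =
            (Fin.cons (f a) (fun i => f (b i)) : Fin (r + 1) → V) := by
          funext i
          refine Fin.cases ?_ (fun i => ?_) i <;> simp
        rw [this, linearIndependent_finCons]
      change _ = ∑ a : α, (if LinearIndependent K
          (fun i => f ((Fin.cons a b : Fin (r + 1) → α) i)) then
          F (Submodule.span K (Set.range fun i => f ((Fin.cons a b : Fin (r + 1) → α) i))) *
            homogeneousSum (tailCount K f (Fin.cons a b : Fin (r + 1) → α)) n r else 0)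
      have hH : ∀ a : α, homogeneousSum (tailCount K f (Fin.cons a b : Fin (r + 1) → α)) n r =
          homogeneousSum (tailCount K f b) n r := fun a =>
        homogeneousSum_congr n r fun j hj => tailCount_cons f a b hj
      simp only [hli, hH, span_range_cons]
      split_ifs with h
      · rw [Finset.sum_mul]
        refine Finset.sum_congr rfl fun a _ => ?_
        by_cases ha : f a ∈ Submodule.span K (Set.range fun i => f (b i)) <;> simp [h, ha]
      · simp [h]

end Words

/-! ### Transposition: from families on an `n`-set to spanning families on an `r`-set. -/

/-- The family of the sets `{i | k ∈ x i}`. -/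
def transposeFamily {ι κ : Type*} [Fintype ι] [DecidableEq κ] (x : ι → Finset κ) (k : κ) :
    Finset ι :=
  Finset.univ.filter fun i => k ∈ x i

theorem mem_transposeFamily {ι κ : Type*} [Fintype ι] [DecidableEq κ] {x : ι → Finset κ} {k : κ}
    {i : ι} : i ∈ transposeFamily x k ↔ k ∈ x i := by
  simp [transposeFamily]

/-- Transposition of families of finite sets. -/
def transposeFamilyEquiv (ι κ : Type*) [Fintype ι] [Fintype κ] [DecidableEq ι] [DecidableEq κ] :
    (ι → Finset κ) ≃ (κ → Finset ι) where
  toFun := transposeFamily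
  invFun := transposeFamily
  left_inv x := by ext; simp [mem_transposeFamily]
  right_inv x := by ext; simp [mem_transposeFamily]

/-- The coordinates separate the points and are nonzero on `W`. -/
def SeparatesCoordinates {K ι : Type*} [Field K] (W : Submodule K (ι → K)) : Prop :=
  (∀ i, ∃ w ∈ W, w i ≠ 0) ∧ ∀ i i', i ≠ i' → ∃ w ∈ W, w i ≠ w i'

/-- A linear relation `w i = w i'` or `w i = 0` holds on the span once it holds on the generating
columns. Thus distinctness and nonemptiness of the rows can serve as the function `F` of the column
space in `sum_words_eq_sum_bases`. -/
theorem separatesCoordinates_span {K ι κ : Type*} [Field K] [Fintype ι] [DecidableEq ι]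
    [DecidableEq κ] (x : ι → Finset κ) :
    SeparatesCoordinates
      (Submodule.span K (Set.range fun k => indicatorVec K (transposeFamily x k))) ↔
      Function.Injective x ∧ ∀ i, (x i).Nonempty := by
  have hmem : ∀ k, indicatorVec K (transposeFamily x k) ∈
      Submodule.span K (Set.range fun k => indicatorVec K (transposeFamily x k)) :=
    fun k => Submodule.subset_span ⟨k, rfl⟩
  have hval : ∀ k i, indicatorVec K (transposeFamily x k) i = if k ∈ x i then 1 else 0 := by
    intro k i
    simp [indicatorVec, mem_transposeFamily]
  constructor
  · rintro ⟨h0, h1⟩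
    refine ⟨fun i i' h => ?_, fun i => ?_⟩
    · by_contra hne
      obtain ⟨w, hw, hwi⟩ := h1 i i' hne
      have hle : Submodule.span K (Set.range fun k => indicatorVec K (transposeFamily x k)) ≤
          LinearMap.ker (LinearMap.proj (R := K) (φ := fun _ : ι => K) i -
            LinearMap.proj (R := K) (φ := fun _ : ι => K) i') := by
        rw [Submodule.span_le]
        rintro _ ⟨k, rfl⟩
        simp [hval, h]
      have := hle hw
      simp only [LinearMap.mem_ker, LinearMap.sub_apply, LinearMap.proj_apply, sub_eq_zero] at this
      exact hwi this
    · by_contra hne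
      rw [Finset.not_nonempty_iff_eq_empty] at hne
      obtain ⟨w, hw, hwi⟩ := h0 i
      have hle : Submodule.span K (Set.range fun k => indicatorVec K (transposeFamily x k)) ≤
          LinearMap.ker (LinearMap.proj (R := K) (φ := fun _ : ι => K) i) := by
        rw [Submodule.span_le]
        rintro _ ⟨k, rfl⟩
        simp [hval, hne]
      exact hwi (hle hw)
  · rintro ⟨hinj, hne⟩
    refine ⟨fun i => ?_, fun i i' h => ?_⟩
    · obtain ⟨k, hk⟩ := hne i
      exact ⟨_, hmem k, by simp [hval, hk]⟩
    · have : ∃ k, ¬ (k ∈ x i ↔ k ∈ x i') := by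
        by_contra hcon
        push Not at hcon
        exact h (hinj (Finset.ext hcon))
      obtain ⟨k, hk⟩ := this
      refine ⟨_, hmem k, ?_⟩
      rw [hval, hval]
      by_cases h1 : k ∈ x i <;> by_cases h2 : k ∈ x i' <;> simp_all

theorem rank_incidenceMatrix_eq_finrank_span {K ι κ : Type*} [Field K] [Fintype ι] [DecidableEq ι]
    [Fintype κ] [DecidableEq κ] (x : ι → Finset κ) :
    (incidenceMatrix K x).rank = Module.finrank K
      (Submodule.span K (Set.range fun k => indicatorVec K (transposeFamily x k))) := by
  rw [Matrix.rank_eq_finrank_span_cols]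
  have : (incidenceMatrix K x).col = fun k => indicatorVec K (transposeFamily x k) := by
    ext k i
    simp [incidenceMatrix, indicatorVec, mem_transposeFamily, Matrix.col]
  rw [this]

/-- The number of linear forms in the last `j` of `r` coordinates that take only the values `0`
and `1` on the indicator vectors of the members of `T`. -/
noncomputable def zeroOneFormCount (K : Type*) [Field K] {r : ℕ} (T : Finset (Finset (Fin r)))
    (j : ℕ) : ℤ :=
  Nat.card {c : Fin r → K // (∀ i : Fin r, (i : ℕ) + j < r → c i = 0) ∧
    ∀ t ∈ T, ∑ i ∈ t, c i = 0 ∨ ∑ i ∈ t, c i = 1}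

/-- The entry at `i` of the combination of the columns with coefficients `c` is the value of the
form `c` on the set `y i`. As the columns are independent, the zero-one vectors in their span
correspond to the forms with values 0 and 1. -/
theorem tailCount_transposeFamily {K : Type*} [Field K] {m r : ℕ} (y : Fin m → Finset (Fin r))
    (hy : LinearIndependent K fun k => indicatorVec K (transposeFamily y k)) (j : ℕ) :
    tailCount K (indicatorVec K) (transposeFamily y) j =
      zeroOneFormCount K (Finset.univ.image y) j := by
  classical
  have hcomb : ∀ (c : Fin r → K) (i : Fin m),
      (∑ k, c k • indicatorVec K (transposeFamily y k)) i = ∑ k ∈ y i, c k := by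
    intro c i
    simp [indicatorVec, mem_transposeFamily, Finset.sum_apply]
  have hmem : ∀ a : Finset (Fin m), indicatorVec K a ∈ Submodule.span K
      ((fun k => indicatorVec K (transposeFamily y k)) '' {k | r ≤ (k : ℕ) + j}) ↔
      ∃ c : Fin r → K, (∀ i : Fin r, (i : ℕ) + j < r → c i = 0) ∧
        ∑ k, c k • indicatorVec K (transposeFamily y k) = indicatorVec K a := by
    intro a
    have hset : {k : Fin r | r ≤ (k : ℕ) + j} =
        ((Finset.univ.filter fun k : Fin r => r ≤ (k : ℕ) + j : Finset (Fin r)) : Set (Fin r)) := by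
      ext; simp
    rw [hset, Submodule.mem_span_image_finset_iff_exists_fun']
    constructor
    · rintro ⟨c, hc⟩
      refine ⟨fun k => if r ≤ (k : ℕ) + j then c k else 0, fun i hi => if_neg (by omega), ?_⟩
      rw [← hc, Finset.sum_filter]
      refine Finset.sum_congr rfl fun k _ => ?_
      by_cases h : r ≤ (k : ℕ) + j
      · simp only [if_pos h]
      · simp only [if_neg h, zero_smul]
    · rintro ⟨c, hc0, hc⟩
      refine ⟨c, ?_⟩
      rw [← hc, Finset.sum_filter]
      refine Finset.sum_congr rfl fun k _ => ?_
      split_ifs with h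
      · rfl
      · rw [hc0 k (by omega), zero_smul]
  rw [tailCount, zeroOneFormCount, Nat.cast_inj, ← Fintype.card_subtype, ← Nat.card_eq_fintype_card]
  have hsum : ∀ c : {c : Fin r → K // (∀ i : Fin r, (i : ℕ) + j < r → c i = 0) ∧
      ∀ t ∈ Finset.univ.image y, ∑ i ∈ t, c i = 0 ∨ ∑ i ∈ t, c i = 1},
      ∑ k, c.1 k • indicatorVec K (transposeFamily y k) =
        indicatorVec K (Finset.univ.filter fun i => ∑ k ∈ y i, c.1 k = 1) := by
    intro c
    ext i
    rw [hcomb]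
    have := c.2.2 (y i) (by simp)
    simp only [indicatorVec, Finset.mem_filter, Finset.mem_univ, true_and]
    rcases this with h | h <;> simp [h]
  symm
  refine Nat.card_eq_of_bijective
    (fun c => ⟨Finset.univ.filter fun i => ∑ k ∈ y i, c.1 k = 1,
      (hmem _).2 ⟨c.1, c.2.1, hsum c⟩⟩) ⟨fun c c' h => ?_, fun a => ?_⟩
  · have h' : (Finset.univ.filter fun i => ∑ k ∈ y i, c.1 k = 1) =
        Finset.univ.filter fun i => ∑ k ∈ y i, c'.1 k = 1 := congrArg Subtype.val h
    have h2 := hsum c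
    rw [h', ← hsum c'] at h2
    ext k
    have h3 := Fintype.linearIndependent_iff.1 hy (fun k => c.1 k - c'.1 k)
      (by simp only [sub_smul, Finset.sum_sub_distrib]; rw [h2, sub_self]) k
    exact sub_eq_zero.1 h3
  · obtain ⟨c, hc0, hc⟩ := (hmem a.1).1 a.2
    have hval : ∀ i, ∑ k ∈ y i, c k = if i ∈ a.1 then 1 else 0 := by
      intro i
      rw [← hcomb, hc, indicatorVec]
    refine ⟨⟨c, hc0, ?_⟩, Subtype.ext ?_⟩
    · intro t ht
      obtain ⟨i, -, rfl⟩ := Finset.mem_image.1 ht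
      rw [hval]
      split_ifs <;> simp
    · ext i
      simp [hval]

open Classical in
theorem sum_injective_families {K : Type*} [Field K] (m n r : ℕ) :
    (∑ x : Fin m → Finset (Fin n), if Function.Injective x then
      (if (∀ I ∈ Finset.univ.image x, I.Nonempty) ∧ familyRank K (Finset.univ.image x) = r then
        (1 : ℤ) else 0) else 0) =
    ∑ y : Fin m → Finset (Fin r), if Function.Injective y then
      (if (∀ I ∈ Finset.univ.image y, I.Nonempty) ∧ familyRank K (Finset.univ.image y) = r then
        homogeneousSum (zeroOneFormCount K (Finset.univ.image y)) n r else 0) else 0 := by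
  have hw := sum_words_eq_sum_bases (K := K) (indicatorVec K (ι := Fin m)) n r
    (fun W => if SeparatesCoordinates W then 1 else 0)
  rw [← (transposeFamilyEquiv (Fin m) (Fin n)).sum_comp,
    ← (transposeFamilyEquiv (Fin m) (Fin r)).sum_comp] at hw
  simp only [transposeFamilyEquiv, Equiv.coe_fn_mk, separatesCoordinates_span] at hw
  convert hw using 1
  · refine Finset.sum_congr rfl fun x _ => ?_
    rw [familyRank_image, rank_incidenceMatrix_eq_finrank_span]
    simp only [Finset.mem_image, Finset.mem_univ, true_and, forall_exists_index,
      forall_apply_eq_imp_iff]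
    by_cases h1 : Function.Injective x <;> by_cases h2 : ∀ i, (x i).Nonempty <;> simp [h1, h2]
    congr
  · refine Finset.sum_congr rfl fun y _ => ?_
    have hli : (LinearIndependent K fun k => indicatorVec K (transposeFamily y k)) ↔
        familyRank K (Finset.univ.image y) = r := by
      rw [familyRank_image, rank_incidenceMatrix_eq_finrank_span,
        linearIndependent_iff_card_eq_finrank_span, Fintype.card_fin, Set.finrank, eq_comm]
    simp only [Finset.mem_image, Finset.mem_univ, true_and, forall_exists_index,
      forall_apply_eq_imp_iff]
    by_cases h3 : LinearIndependent K fun k => indicatorVec K (transposeFamily y k)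
    · rw [if_pos h3, funext (tailCount_transposeFamily y h3)]
      have h4 := hli.1 h3
      by_cases h1 : Function.Injective y <;> by_cases h2 : ∀ i, (y i).Nonempty <;>
        simp [h1, h2, h4]
    · rw [if_neg h3]
      have h4 := fun h => h3 (hli.2 h)
      split_ifs with h1 h2
      · exact (h4 h2.2).elim
      · rfl
      · rfl

open Classical in
-- Each set with `m` elements is the image of `m!` injections; this passes from matrices with
-- ordered rows to families.
theorem sum_injective_eq_factorial_mul {X : Type*} [Fintype X] [DecidableEq X] (m : ℕ)
    (φ : Finset X → ℤ) :
    (∑ x : Fin m → X, if Function.Injective x then φ (Finset.univ.image x) else 0) =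
      m.factorial * ∑ S : Finset X, if S.card = m then φ S else 0 := by
  rw [← Finset.sum_filter, ← Finset.sum_fiberwise (s := Finset.univ.filter _)
    (g := fun x : Fin m → X => Finset.univ.image x), Finset.mul_sum]
  refine Finset.sum_congr rfl fun S _ => ?_
  have h1 : ∀ x ∈ (Finset.univ.filter fun x : Fin m → X => Function.Injective x).filter
      (fun x => Finset.univ.image x = S), φ (Finset.univ.image x) = φ S := by
    intro x hx
    rw [(Finset.mem_filter.1 hx).2]
  rw [Finset.sum_congr rfl h1, Finset.sum_const, nsmul_eq_mul, Finset.filter_filter]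
  split_ifs with hS
  · congr 2
    have e : Fin m ≃ S := (Fintype.equivFinOfCardEq (by simpa using hS)).symm
    have h2 := Fintype.card_equiv e
    rw [Fintype.card_fin] at h2
    rw [← h2, ← Fintype.card_subtype]
    refine Fintype.card_congr ⟨fun x => Equiv.ofBijective
      (fun i => (⟨x.1 i, by
        have := Finset.mem_image_of_mem x.1 (Finset.mem_univ i)
        rwa [x.2.2] at this⟩ : S))
        ⟨fun i j h => x.2.1 (congrArg Subtype.val h), fun s => ?_⟩,
      fun f => ⟨fun i => (f i : X), fun i j h => f.injective (Subtype.ext h), ?_⟩,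
      fun x => rfl, fun f => by ext; rfl⟩
    · obtain ⟨s, hs⟩ := s
      obtain ⟨x, hx1, hx2⟩ := x
      rw [← hx2] at hs
      obtain ⟨i, -, hi⟩ := Finset.mem_image.1 hs
      exact ⟨i, Subtype.ext hi⟩
    · ext s
      simp only [Finset.mem_image, Finset.mem_univ, true_and]
      exact ⟨fun ⟨i, hi⟩ => hi ▸ (f i).2, fun hs => ⟨f.symm ⟨s, hs⟩, by simp⟩⟩
  · rw [mul_zero]
    have : (Finset.univ.filter fun x : Fin m → X => Function.Injective x ∧
        Finset.univ.image x = S) = ∅ := by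
      refine Finset.filter_eq_empty_iff.2 fun x _ h => hS ?_
      rw [← h.2, Finset.card_image_of_injective _ h.1]
      simp
    rw [this]
    simp

open Classical in
/-- The signed count of the families of rank `r` of subsets of an `n`-set as a sum over the
spanning families of subsets of an `r`-set. -/
theorem sum_families_eq_sum_spanning_families (K : Type*) [Field K] (n r : ℕ) :
    (∑ S : Finset (Finset (Fin n)),
      if (∀ I ∈ S, I.Nonempty) ∧ familyRank K S = r then (-1 : ℤ) ^ S.card else 0) =
    ∑ T : Finset (Finset (Fin r)),
      if (∀ I ∈ T, I.Nonempty) ∧ familyRank K T = r then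
        (-1 : ℤ) ^ T.card * homogeneousSum (zeroOneFormCount K T) n r else 0 := by
  have hm : ∀ m : ℕ, (∑ S : Finset (Finset (Fin n)), if S.card = m then
        (if (∀ I ∈ S, I.Nonempty) ∧ familyRank K S = r then (1 : ℤ) else 0) else 0) =
      ∑ T : Finset (Finset (Fin r)), if T.card = m then
        (if (∀ I ∈ T, I.Nonempty) ∧ familyRank K T = r then
          homogeneousSum (zeroOneFormCount K T) n r else 0) else 0 := by
    intro m
    have h := sum_injective_families (K := K) m n r
    rw [sum_injective_eq_factorial_mul m fun S : Finset (Finset (Fin n)) =>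
        if (∀ I ∈ S, I.Nonempty) ∧ familyRank K S = r then (1 : ℤ) else 0,
      sum_injective_eq_factorial_mul m fun T : Finset (Finset (Fin r)) =>
        if (∀ I ∈ T, I.Nonempty) ∧ familyRank K T = r then
          homogeneousSum (zeroOneFormCount K T) n r else 0] at h
    exact mul_left_cancel₀ (by exact_mod_cast m.factorial_ne_zero) h
  -- The sign depends on the cardinality only, so the identity for each `m` suffices; `N` is any
  -- common bound for the cardinalities on the two sides.
  have hgen : ∀ {X : Type} [Fintype X] (N : ℕ) (_ : Fintype.card X < N) (φ : Finset X → ℤ),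
      ∑ S : Finset X, (-1 : ℤ) ^ S.card * φ S =
        ∑ m ∈ Finset.range N, (-1 : ℤ) ^ m * ∑ S : Finset X, if S.card = m then φ S else 0 := by
    intro X _ N hN φ
    simp only [Finset.mul_sum]
    rw [Finset.sum_comm]
    refine Finset.sum_congr rfl fun S _ => ?_
    rw [Finset.sum_eq_single_of_mem S.card (Finset.mem_range.2 (S.card_le_univ.trans_lt hN))]
    · simp
    · intro m _ hne
      rw [if_neg (Ne.symm hne), mul_zero]
  have hl := hgen (Fintype.card (Finset (Fin n)) + Fintype.card (Finset (Fin r)) + 1)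
    (by omega) (fun S : Finset (Finset (Fin n)) =>
      if (∀ I ∈ S, I.Nonempty) ∧ familyRank K S = r then (1 : ℤ) else 0)
  have hr := hgen (Fintype.card (Finset (Fin n)) + Fintype.card (Finset (Fin r)) + 1)
    (by omega) (fun T : Finset (Finset (Fin r)) =>
      if (∀ I ∈ T, I.Nonempty) ∧ familyRank K T = r then
          homogeneousSum (zeroOneFormCount K T) n r else 0)
  simp only [hm, mul_ite, mul_one, mul_zero] at hl hr
  exact hl.trans hr.symm

/-! ### Greedy bases of spanning sets in a linear order. -/

section LeadingBasis

variable {K V E : Type*} [Field K] [AddCommGroup V] [Module K V] [LinearOrder E]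

open Classical in
/-- The members of `T` whose vector is not in the span of the vectors of the earlier members. -/
noncomputable def leadingBasis (K : Type*) {V E : Type*} [Field K] [AddCommGroup V] [Module K V]
    [LinearOrder E] (φ : E → V) (T : Finset E) : Finset E :=
  T.filter fun t => φ t ∉ Submodule.span K (φ '' {s | s ∈ T ∧ s < t})

theorem mem_leadingBasis {φ : E → V} {T : Finset E} {t : E} : t ∈ leadingBasis K φ T ↔
    t ∈ T ∧ φ t ∉ Submodule.span K (φ '' {s | s ∈ T ∧ s < t}) := by
  simp [leadingBasis]

theorem leadingBasis_subset (φ : E → V) (T : Finset E) : leadingBasis K φ T ⊆ T :=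
  fun _ h => (mem_leadingBasis.1 h).1

theorem mem_span_leadingBasis [WellFoundedLT E] (φ : E → V) (T : Finset E) (t : E) (ht : t ∈ T) :
    φ t ∈ Submodule.span K (φ '' {s | s ∈ leadingBasis K φ T ∧ s ≤ t}) := by
  induction t using WellFoundedLT.induction with
  | ind t ih =>
    by_cases h : t ∈ leadingBasis K φ T
    · exact Submodule.subset_span ⟨t, ⟨h, le_rfl⟩, rfl⟩
    · have h1 : φ t ∈ Submodule.span K (φ '' {s | s ∈ T ∧ s < t}) := by
        by_contra hcon
        exact h (mem_leadingBasis.2 ⟨ht, hcon⟩)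
      refine (Submodule.span_le.2 ?_) h1
      rintro _ ⟨s, ⟨hs, hst⟩, rfl⟩
      refine Submodule.span_mono (Set.image_mono ?_) (ih s hst hs)
      rintro u ⟨hu, hus⟩
      exact ⟨hu, hus.trans hst.le⟩

theorem span_leadingBasis_lt [WellFoundedLT E] (φ : E → V) (T : Finset E) (t : E) :
    Submodule.span K (φ '' {s | s ∈ leadingBasis K φ T ∧ s < t}) =
      Submodule.span K (φ '' {s | s ∈ T ∧ s < t}) := by
  refine le_antisymm (Submodule.span_mono (Set.image_mono ?_)) (Submodule.span_le.2 ?_)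
  · rintro s ⟨hs, hst⟩
    exact ⟨leadingBasis_subset φ T hs, hst⟩
  · rintro _ ⟨s, ⟨hs, hst⟩, rfl⟩
    refine Submodule.span_mono (Set.image_mono ?_) (mem_span_leadingBasis φ T s hs)
    rintro u ⟨hu, hus⟩
    exact ⟨hu, hus.trans_lt hst⟩

theorem span_leadingBasis [WellFoundedLT E] (φ : E → V) (T : Finset E) :
    Submodule.span K (φ '' (leadingBasis K φ T : Set E)) = Submodule.span K (φ '' (T : Set E)) := by
  refine le_antisymm (Submodule.span_mono (Set.image_mono ?_)) (Submodule.span_le.2 ?_)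
  · exact_mod_cast leadingBasis_subset φ T
  · rintro _ ⟨s, hs, rfl⟩
    refine Submodule.span_mono (Set.image_mono ?_) (mem_span_leadingBasis φ T s hs)
    rintro u ⟨hu, -⟩
    exact hu

theorem linearIndepOn_of_notMem_span_lt (φ : E → V) (B : Finset E)
    (h : ∀ b ∈ B, φ b ∉ Submodule.span K (φ '' {s | s ∈ B ∧ s < b})) :
    LinearIndepOn K φ (B : Set E) := by
  classical
  induction B using Finset.induction_on_max with
  | empty => simp
  | insert a B hlt ih =>
    rw [Finset.coe_insert]
    refine LinearIndepOn.insert (ih fun b hb hcon => ?_) fun hcon => ?_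
    · refine h b (Finset.mem_insert_of_mem hb) (Submodule.span_mono (Set.image_mono ?_) hcon)
      rintro s ⟨hs, hsb⟩
      exact ⟨Finset.mem_insert_of_mem hs, hsb⟩
    · refine h a (Finset.mem_insert_self _ _) (Submodule.span_mono (Set.image_mono ?_) hcon)
      intro s hs
      exact ⟨Finset.mem_insert_of_mem hs, hlt s hs⟩

theorem linearIndepOn_leadingBasis [WellFoundedLT E] (φ : E → V) (T : Finset E) :
    LinearIndepOn K φ (leadingBasis K φ T : Set E) := by
  refine linearIndepOn_of_notMem_span_lt φ _ fun b hb => ?_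
  rw [span_leadingBasis_lt]
  exact (mem_leadingBasis.1 hb).2

theorem notMem_span_lt_of_linearIndepOn {φ : E → V} {B : Finset E}
    (hB : LinearIndepOn K φ (B : Set E)) {b : E} (hb : b ∈ B) :
    φ b ∉ Submodule.span K (φ '' {s | s ∈ B ∧ s < b}) := by
  intro h
  refine hB.notMem_span (i := b) hb (Submodule.span_mono (Set.image_mono ?_) h)
  rintro s ⟨hs, hsb⟩
  exact ⟨hs, hsb.ne⟩

/-- Adding `U` does not change the span of the members before any given `t`, hence no greedy choice
changes. -/
theorem leadingBasis_union {φ : E → V} {B U : Finset E} (hB : LinearIndepOn K φ (B : Set E))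
    (hU : ∀ u ∈ U, φ u ∈ Submodule.span K (φ '' {s | s ∈ B ∧ s < u})) :
    leadingBasis K φ (B ∪ U) = B := by
  have hspan : ∀ t, Submodule.span K (φ '' {s | s ∈ B ∪ U ∧ s < t}) =
      Submodule.span K (φ '' {s | s ∈ B ∧ s < t}) := by
    intro t
    refine le_antisymm (Submodule.span_le.2 ?_) (Submodule.span_mono (Set.image_mono ?_))
    · rintro _ ⟨s, ⟨hs, hst⟩, rfl⟩
      rcases Finset.mem_union.1 hs with hs | hs
      · exact Submodule.subset_span ⟨s, ⟨hs, hst⟩, rfl⟩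
      · refine Submodule.span_mono (Set.image_mono ?_) (hU s hs)
        rintro u ⟨hu, hus⟩
        exact ⟨hu, hus.trans hst⟩
    · rintro s ⟨hs, hst⟩
      exact ⟨Finset.mem_union_left _ hs, hst⟩
  ext t
  rw [mem_leadingBasis, hspan, Finset.mem_union]
  constructor
  · rintro ⟨h | h, hn⟩
    · exact h
    · exact (hn (hU t h)).elim
  · intro h
    exact ⟨Or.inl h, notMem_span_lt_of_linearIndepOn hB h⟩

open Classical in
/-- Sorting the spanning sets by their leading bases. -/
theorem sum_spanning_eq_sum_leadingBasis [WellFoundedLT E] {R : Type*} [AddCommMonoid R]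
    (φ : E → V) (X : Finset E) (f : Finset E → R) :
    (∑ T ∈ X.powerset, if Submodule.span K (φ '' (T : Set E)) = ⊤ then f T else 0) =
      ∑ B ∈ X.powerset,
        if LinearIndepOn K φ (B : Set E) ∧ Submodule.span K (φ '' (B : Set E)) = ⊤ then
          ∑ U ∈ (X.filter fun u => φ u ∈ Submodule.span K (φ '' {s | s ∈ B ∧ s < u})).powerset,
            f (B ∪ U) else 0 := by
  have hmaps : ∀ T ∈ X.powerset, leadingBasis K φ T ∈ X.powerset := fun T hT =>
    Finset.mem_powerset.2 ((leadingBasis_subset φ T).trans (Finset.mem_powerset.1 hT))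
  rw [← Finset.sum_fiberwise_of_maps_to hmaps]
  refine Finset.sum_congr rfl fun B hBX => ?_
  rw [Finset.mem_powerset] at hBX
  split_ifs with hB
  · symm
    refine Finset.sum_nbij' (fun U => B ∪ U) (fun T => T \ B) ?_ ?_ ?_ ?_ ?_
    · intro U hU
      rw [Finset.mem_powerset] at hU
      refine Finset.mem_filter.2 ⟨Finset.mem_powerset.2 (Finset.union_subset hBX fun u hu =>
        (Finset.mem_filter.1 (hU hu)).1), leadingBasis_union hB.1 fun u hu =>
        (Finset.mem_filter.1 (hU hu)).2⟩
    · intro T hT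
      obtain ⟨hTX, rfl⟩ := Finset.mem_filter.1 hT
      refine Finset.mem_powerset.2 fun u hu => ?_
      obtain ⟨huT, hu⟩ := Finset.mem_sdiff.1 hu
      refine Finset.mem_filter.2 ⟨Finset.mem_powerset.1 hTX huT, ?_⟩
      rw [span_leadingBasis_lt]
      by_contra hcon
      exact hu (mem_leadingBasis.2 ⟨huT, hcon⟩)
    · intro U hU
      rw [Finset.mem_powerset] at hU
      refine Finset.union_sdiff_cancel_left (Finset.disjoint_left.2 fun u hu huU => ?_)
      exact notMem_span_lt_of_linearIndepOn hB.1 hu (Finset.mem_filter.1 (hU huU)).2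
    · intro T hT
      obtain ⟨-, rfl⟩ := Finset.mem_filter.1 hT
      exact Finset.union_sdiff_of_subset (leadingBasis_subset φ T)
    · intro U hU
      rw [Finset.mem_powerset] at hU
      rw [if_pos]
      rw [eq_top_iff, ← hB.2]
      exact Submodule.span_mono (Set.image_mono (by simp))
  · refine Finset.sum_eq_zero fun T hT => if_neg fun hspan => hB ?_
    obtain ⟨-, rfl⟩ := Finset.mem_filter.1 hT
    exact ⟨linearIndepOn_leadingBasis φ T, (span_leadingBasis φ T).trans hspan⟩

end LeadingBasis

/-! ### Subsets of a four-element set as the numbers below 16. -/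

/-- The binary digit of `y` at place `i`. -/
def bitNat (y i : ℕ) : ℕ := Nat.mod (Nat.shiftRight y i) 2

theorem bitNat_le_one (y i : ℕ) : bitNat y i ≤ 1 :=
  Nat.le_of_lt_succ (Nat.mod_lt _ two_pos)

theorem bitNat_eq_zero_or_one (y i : ℕ) : bitNat y i = 0 ∨ bitNat y i = 1 := by
  have := bitNat_le_one y i
  omega

/-- The set of the places `< 4` where `y` has the binary digit `1`. -/
def bitSet (y : ℕ) : Finset (Fin 4) := Finset.univ.filter fun i => bitNat y i = 1

theorem sum_bitSet {K : Type*} [Field K] (y : ℕ) (c : Fin 4 → K) :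
    ∑ i ∈ bitSet y, c i = ∑ i : Fin 4, (bitNat y i : K) * c i := by
  rw [bitSet, Finset.sum_filter]
  refine Finset.sum_congr rfl fun i _ => ?_
  rcases bitNat_eq_zero_or_one y i with h | h <;> simp [h]

/-- The vector of the lowest four binary digits. -/
def bitVec (K : Type*) [Field K] (y : ℕ) : Fin 4 → K := fun i => (bitNat y i : K)

theorem indicatorVec_bitSet (K : Type*) [Field K] (y : ℕ) :
    indicatorVec K (bitSet y) = bitVec K y := by
  funext i
  rcases bitNat_eq_zero_or_one y i with h | h <;> simp [indicatorVec, bitSet, bitVec, h]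

theorem bitNat_two_pow (i l : Fin 4) : bitNat (2 ^ (i : ℕ)) l = if l = i then 1 else 0 := by
  revert i l
  decide

theorem exists_bitNat_eq (p : Fin 4 → Prop) :
    ∃ z < 16, ∀ l : Fin 4, (bitNat z l = 1 ↔ p l) := by
  classical
  have h : ∀ q : Fin 4 → Bool, ∃ z < 16, ∀ l : Fin 4, (bitNat z l = 1 ↔ q l = true) := by
    decide
  simpa using h fun l => decide (p l)

theorem eq_of_bitNat_eq : ∀ z < 16, ∀ z' < 16, (∀ l : Fin 4, bitNat z l = bitNat z' l) →
    z = z' := by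
  decide

theorem bitSet_injOn : Set.InjOn bitSet (Finset.Icc 1 15 : Finset ℕ) := by
  intro z hz z' hz' h
  simp only [Finset.coe_Icc, Set.mem_Icc] at hz hz'
  refine eq_of_bitNat_eq z (by omega) z' (by omega) fun l => ?_
  have h1 : l ∈ bitSet z ↔ l ∈ bitSet z' := by rw [h]
  simp only [bitSet, Finset.mem_filter, Finset.mem_univ, true_and] at h1
  have := bitNat_le_one z l
  have := bitNat_le_one z' l
  omega

theorem image_bitSet_Icc :
    (Finset.Icc 1 15).image bitSet = Finset.univ.filter fun I : Finset (Fin 4) => I.Nonempty := by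
  decide

open Classical in
theorem sum_families_four_eq {K : Type*} [Field K] (f : Finset (Finset (Fin 4)) → ℤ) :
    (∑ T : Finset (Finset (Fin 4)), if (∀ I ∈ T, I.Nonempty) ∧ familyRank K T = 4 then f T else 0) =
      ∑ T ∈ (Finset.Icc 1 15).powerset,
        if Submodule.span K (bitVec K '' (T : Set ℕ)) = ⊤ then f (T.image bitSet) else 0 := by
  have hrank : ∀ T : Finset ℕ, familyRank K (T.image bitSet) = 4 ↔
      Submodule.span K (bitVec K '' (T : Set ℕ)) = ⊤ := by
    intro T
    have h1 : T.image bitSet = Finset.univ.image fun t : T => bitSet t := by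
      ext I
      simp
    have h2 : (incidenceMatrix K fun t : T => bitSet t).row = fun t : T => bitVec K t := by
      funext t
      exact indicatorVec_bitSet K t
    have h3 : Set.range (fun t : T => bitVec K t) = bitVec K '' (T : Set ℕ) := by
      ext v
      simp
    rw [h1, familyRank_image, Matrix.rank_eq_finrank_span_row, h2, h3]
    constructor
    · intro h
      exact Submodule.eq_top_of_finrank_eq (by simpa using h)
    · intro h
      rw [h]
      simp
  rw [← Finset.sum_filter, ← Finset.sum_filter]
  symm
  refine Finset.sum_bij (fun T _ => T.image bitSet) ?_ ?_ ?_ ?_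
  · intro T hT
    obtain ⟨hT, hspan⟩ := Finset.mem_filter.1 hT
    refine Finset.mem_filter.2 ⟨Finset.mem_univ _, fun I hI => ?_, (hrank T).2 hspan⟩
    have := Finset.image_subset_image (f := bitSet) (Finset.mem_powerset.1 hT) hI
    rw [image_bitSet_Icc] at this
    simpa using this
  · intro T hT T' hT' h
    have hT1 := Finset.mem_powerset.1 (Finset.mem_filter.1 hT).1
    have hT2 := Finset.mem_powerset.1 (Finset.mem_filter.1 hT').1
    have h' : bitSet '' (T : Set ℕ) = bitSet '' (T' : Set ℕ) := by
      rw [← Finset.coe_image, ← Finset.coe_image, h]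
    exact_mod_cast (bitSet_injOn.image_eq_image_iff (by exact_mod_cast hT1)
      (by exact_mod_cast hT2)).1 h'
  · intro T hT
    obtain ⟨-, hne, hr⟩ := Finset.mem_filter.1 hT
    have hsub : T ⊆ (Finset.Icc 1 15).image bitSet := by
      rw [image_bitSet_Icc]
      intro I hI
      simpa using hne I hI
    obtain ⟨S, hS, rfl⟩ := Finset.subset_image_iff.1 hsub
    exact ⟨S, Finset.mem_filter.2 ⟨Finset.mem_powerset.2 (by exact_mod_cast hS),
      (hrank S).1 hr⟩, rfl⟩
  · intro T _
    rfl

/-! ### Integral coordinates with respect to a basis, and Cramer's rule. -/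

/-- `lam y` are `D` times the coordinates of the digit vector of `y` with respect to the basis of
the digit vectors of `β`. -/
structure IsScaledCoordinates (β : Fin 4 → ℕ) (lam : ℕ → Fin 4 → ℤ) (D : ℤ) : Prop where
  sum_mul : ∀ (y : ℕ) (i : Fin 4), ∑ l, lam y l * bitNat (β l) i = D * bitNat y i
  linear : ∀ y l, lam y l = ∑ i : Fin 4, bitNat y i * lam (2 ^ (i : ℕ)) l
  apply_basis : ∀ k l, lam (β k) l = if k = l then D else 0

namespace IsScaledCoordinates

variable {K : Type*} [Field K] [CharZero K] {β : Fin 4 → ℕ} {lam : ℕ → Fin 4 → ℤ} {D : ℤ}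

theorem bitVec_mem_span_iff (h : IsScaledCoordinates β lam D) (hD : D ≠ 0) (y : ℕ) :
    bitVec K y ∈ Submodule.span K
      (bitVec K '' {s | s ∈ Finset.univ.image β ∧ s < y}) ↔ ∀ l, β l < y ∨ lam y l = 0 := by
  have hDK : (D : K) ≠ 0 := by exact_mod_cast hD
  constructor
  · intro hy l
    by_contra! hcon
    -- This functional reads off the scaled coordinate `l`. It vanishes on every basis vector except
    -- number `l`, which is not among the earlier ones here.
    let g : (Fin 4 → K) →ₗ[K] K := ∑ i : Fin 4, (lam (2 ^ (i : ℕ)) l : K) • LinearMap.proj i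
    have hg : ∀ y, g (bitVec K y) = lam y l := by
      intro y
      rw [h.linear y l]
      simp [g, bitVec, mul_comm]
    have hle : Submodule.span K (bitVec K '' {s | s ∈ Finset.univ.image β ∧ s < y}) ≤
        LinearMap.ker g := by
      rw [Submodule.span_le]
      rintro _ ⟨s, ⟨hs, hsy⟩, rfl⟩
      obtain ⟨k, -, rfl⟩ := Finset.mem_image.1 hs
      have hkl : k ≠ l := by
        rintro rfl
        omega
      simp [hg, h.apply_basis, hkl]
    have := hle hy
    rw [LinearMap.mem_ker, hg] at this
    exact hcon.2 (by exact_mod_cast this)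
  · intro hl
    have hsum : bitVec K y = ∑ l, ((D : K)⁻¹ * (lam y l : K)) • bitVec K (β l) := by
      funext i
      have := h.sum_mul y i
      have h2 : ∑ l, (lam y l : K) * (bitNat (β l) i : K) = D * bitNat y i := by
        exact_mod_cast this
      simp only [Finset.sum_apply, Pi.smul_apply, smul_eq_mul, bitVec, mul_assoc]
      rw [← Finset.mul_sum, h2, inv_mul_cancel_left₀ hDK]
    rw [hsum]
    refine Submodule.sum_mem _ fun l _ => ?_
    rcases hl l with h1 | h1
    · exact Submodule.smul_mem _ _ (Submodule.subset_span ⟨β l, ⟨by simp, h1⟩, rfl⟩)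
    · rw [h1]
      simp

theorem linearIndepOn (h : IsScaledCoordinates β lam D) (hD : D ≠ 0) :
    LinearIndepOn K (bitVec K) ((Finset.univ.image β : Finset ℕ) : Set ℕ) := by
  refine linearIndepOn_of_notMem_span_lt _ _ fun b hb => ?_
  obtain ⟨k, -, rfl⟩ := Finset.mem_image.1 hb
  rw [h.bitVec_mem_span_iff hD]
  intro hcon
  rcases hcon k with h1 | h1
  · exact lt_irrefl _ h1
  · rw [h.apply_basis, if_pos rfl] at h1
    exact hD h1

theorem span_eq_top (h : IsScaledCoordinates β lam D) (hD : D ≠ 0) :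
    Submodule.span K (bitVec K '' ((Finset.univ.image β : Finset ℕ) : Set ℕ)) = ⊤ := by
  have h1 : LinearIndependent K fun b : (Finset.univ.image β : Finset ℕ) => bitVec K b :=
    h.linearIndepOn hD
  have hinj : Function.Injective β := by
    intro k l hkl
    by_contra hne
    have h2 := h.apply_basis k l
    rw [hkl, h.apply_basis, if_pos rfl, if_neg hne] at h2
    exact hD h2
  have h2 := h1.span_eq_top_of_card_eq_finrank' (by
    rw [Fintype.card_coe, Finset.card_image_of_injective _ hinj]
    simp)
  rw [← h2]
  congr 1
  ext v
  simp

/-- A form is determined by its values on the basis; these are 0 or 1 and become the binary digits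
of `z`. Its value on `u` is then `(∑ z_l * lam u l) / D`, and its coefficients are the values on the
unit vectors, coded by `2 ^ i`. -/
theorem zeroOneFormCount_eq (h : IsScaledCoordinates β lam D) (hD : D ≠ 0) (U : Finset ℕ)
    (j : ℕ) :
    zeroOneFormCount K ((Finset.univ.image β ∪ U).image bitSet) j =
      ((Finset.range 16).filter fun z =>
        (∀ i : Fin 4, (i : ℕ) + j < 4 → ∑ l : Fin 4, bitNat z l * lam (2 ^ (i : ℕ)) l = 0) ∧
        ∀ u ∈ U, ∑ l : Fin 4, bitNat z l * lam u l = 0 ∨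
          ∑ l : Fin 4, bitNat z l * lam u l = D).card := by
  have hDK : (D : K) ≠ 0 := by exact_mod_cast hD
  rw [zeroOneFormCount, Nat.cast_inj]
  let c : ℕ → Fin 4 → K := fun z i =>
    (((∑ l : Fin 4, bitNat z l * lam (2 ^ (i : ℕ)) l : ℤ)) : K) / D
  have hc : ∀ z u, ∑ i ∈ bitSet u, c z i = ((∑ l : Fin 4, bitNat z l * lam u l : ℤ) : K) / D := by
    intro z u
    rw [sum_bitSet]
    simp only [c, mul_div_assoc', ← Finset.sum_div]
    congr 1
    norm_cast
    simp only [h.linear u, Finset.mul_sum]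
    rw [Finset.sum_comm]
    refine Finset.sum_congr rfl fun l _ => Finset.sum_congr rfl fun i _ => by ring
  have hcβ : ∀ z k, ∑ i ∈ bitSet (β k), c z i = bitNat z k := by
    intro z k
    rw [hc]
    simp [h.apply_basis, hDK]
  have h01 : ∀ x : ℤ, ((x : K) / D = 0 ↔ x = 0) ∧ ((x : K) / D = 1 ↔ x = D) := by
    intro x
    refine ⟨by simp [hD], ?_⟩
    rw [div_eq_one_iff_eq hDK]
    norm_cast
  rw [← Fintype.card_coe, ← Nat.card_eq_fintype_card]
  symm
  refine Nat.card_eq_of_bijective (fun z => ⟨c z.1, ?_, ?_⟩) ⟨?_, ?_⟩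
  · intro i hi
    exact (h01 _).1.2 ((Finset.mem_filter.1 z.2).2.1 i hi)
  · intro t ht
    obtain ⟨u, hu, rfl⟩ := Finset.mem_image.1 ht
    rcases Finset.mem_union.1 hu with hu | hu
    · obtain ⟨k, -, rfl⟩ := Finset.mem_image.1 hu
      rw [hcβ]
      rcases bitNat_eq_zero_or_one z k with h1 | h1 <;> simp [h1]
    · rw [hc, (h01 _).1, (h01 _).2]
      exact (Finset.mem_filter.1 z.2).2.2 u hu
  · intro z z' hzz
    have hcc : c z = c z' := congrArg Subtype.val hzz
    refine Subtype.ext (eq_of_bitNat_eq _ (Finset.mem_range.1 (Finset.mem_filter.1 z.2).1) _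
      (Finset.mem_range.1 (Finset.mem_filter.1 z'.2).1) fun k => ?_)
    have h1 := hcβ z k
    rw [hcc, hcβ] at h1
    exact_mod_cast h1.symm
  · rintro ⟨e, he0, he⟩
    obtain ⟨z, hz, hzl⟩ := exists_bitNat_eq fun k => ∑ i ∈ bitSet (β k), e i = 1
    have hzk : ∀ k : Fin 4, (bitNat z k : K) = ∑ i ∈ bitSet (β k), e i := by
      intro k
      have h1 := he (bitSet (β k)) (Finset.mem_image_of_mem _ (Finset.mem_union_left _ (by simp)))
      rcases bitNat_eq_zero_or_one z k with h2 | h2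
      · have h3 := mt (hzl k).2 (by omega)
        rw [h2, h1.resolve_right h3, Nat.cast_zero]
      · rw [h2, (hzl k).1 h2, Nat.cast_one]
    -- Expanding the unit vectors in the basis by `sum_mul` recovers the form `e` from its basis
    -- values.
    have hce : c z = e := by
      funext i
      simp only [c]
      rw [div_eq_iff hDK]
      push_cast
      simp only [hzk, sum_bitSet, Finset.sum_mul]
      rw [Finset.sum_comm]
      have h4 : ∀ i' : Fin 4, ∑ l, (bitNat (β l) i' : K) * e i' * (lam (2 ^ (i : ℕ)) l : K) =
          (if i' = i then e i' * D else 0) := by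
        intro i'
        have h5 := h.sum_mul (2 ^ (i : ℕ)) i'
        rw [bitNat_two_pow] at h5
        have h6 : ∑ l, (lam (2 ^ (i : ℕ)) l : K) * (bitNat (β l) i' : K) =
            D * ((if i' = i then 1 else 0 : ℕ) : K) := by
          exact_mod_cast h5
        have h7 : ∑ l, (bitNat (β l) i' : K) * e i' * (lam (2 ^ (i : ℕ)) l : K) =
            e i' * ∑ l, (lam (2 ^ (i : ℕ)) l : K) * (bitNat (β l) i' : K) := by
          rw [Finset.mul_sum]
          exact Finset.sum_congr rfl fun l _ => by ring
        rw [h7, h6]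
        split_ifs <;> simp
      rw [Finset.sum_congr rfl fun i' _ => h4 i']
      simp
    refine ⟨⟨z, Finset.mem_filter.2 ⟨Finset.mem_range.2 hz, fun i hi => ?_, fun u hu => ?_⟩⟩,
      Subtype.ext hce⟩
    · rw [← (h01 _).1]
      have := congrFun hce i
      rw [he0 i hi] at this
      exact this
    · rw [← (h01 _).1, ← (h01 _).2, ← hc, hce]
      exact he _ (Finset.mem_image_of_mem _ (Finset.mem_union_right _ hu))

end IsScaledCoordinates

/-- The minor of the digit matrix of `b, c, d` in the columns `i, j, k`. -/
def minorThree (b c d i j k : ℕ) : ℤ :=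
  bitNat b i * (bitNat c j * bitNat d k) + bitNat b j * (bitNat c k * bitNat d i) +
    bitNat b k * (bitNat c i * bitNat d j) - (bitNat b k * (bitNat c j * bitNat d i) +
    bitNat b j * (bitNat c i * bitNat d k) + bitNat b i * (bitNat c k * bitNat d j))

/-- The determinant of the `4 × 4` digit matrix of `y, b, c, d`. -/
def detFour (y b c d : ℕ) : ℤ :=
  bitNat y 0 * minorThree b c d 1 2 3 - bitNat y 1 * minorThree b c d 0 2 3 +
    bitNat y 2 * minorThree b c d 0 1 3 - bitNat y 3 * minorThree b c d 0 1 2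

/-- The coordinates given by Cramer's rule, without the denominator. -/
def cramerCoords (a b c d y : ℕ) : Fin 4 → ℤ :=
  ![detFour y b c d, -detFour y a c d, detFour y a b d, -detFour y a b c]

/-- Without the denominator, Cramer's rule consists of polynomial identities, valid also for
determinant zero. -/
theorem isScaledCoordinates_cramerCoords (a b c d : ℕ) :
    IsScaledCoordinates ![a, b, c, d] (cramerCoords a b c d) (detFour a b c d) where
  sum_mul y i := by
    fin_cases i <;>
    · simp [Fin.sum_univ_four, cramerCoords, detFour, minorThree]
      ring
  linear y l := by
    have h : ∀ i j : ℕ, i < 4 → j < 4 → bitNat (2 ^ i) j = if j = i then 1 else 0 := by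
      intro i j hi hj
      simpa using bitNat_two_pow ⟨i, hi⟩ ⟨j, hj⟩
    fin_cases l <;>
    · simp [Fin.sum_univ_four, cramerCoords, detFour, h]
      ring
  apply_basis k l := by
    fin_cases k <;> fin_cases l <;>
    · simp [cramerCoords, detFour, minorThree]
      try ring

theorem detFour_ne_zero {K : Type*} [Field K] [CharZero K] {a b c d : ℕ} (hab : a < b) (hbc : b < c)
    (hcd : c < d) (h : LinearIndepOn K (bitVec K) ({a, b, c, d} : Set ℕ)) :
    detFour a b c d ≠ 0 := by
  have hmono : StrictMono ![a, b, c, d] := by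
    intro i j hij
    fin_cases i <;> fin_cases j <;> simp_all <;> omega
  have h1 : LinearIndependent K fun k => bitVec K (![a, b, c, d] k) := by
    refine LinearIndependent.comp (h : LinearIndependent K
      fun x : ({a, b, c, d} : Set ℕ) => bitVec K x) (fun k => ⟨![a, b, c, d] k, by fin_cases k <;> simp⟩) ?_
    intro i j hij
    exact hmono.injective (congrArg Subtype.val hij)
  have h2 := Matrix.linearIndependent_rows_iff_isUnit
    (A := Matrix.of fun k => bitVec K (![a, b, c, d] k)).1 h1
  rw [Matrix.isUnit_iff_isUnit_det] at h2
  have h3 : (Matrix.of fun k => bitVec K (![a, b, c, d] k)).det = (detFour a b c d : K) := by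
    simp [Matrix.det_succ_row_zero, Fin.sum_univ_succ, detFour, minorThree, bitVec, Fin.succAbove]
    ring
  rw [h3] at h2
  intro h4
  rw [h4] at h2
  simp at h2

open Classical in
theorem sum_powersetCard_four {R : Type*} [AddCommMonoid R] (X : Finset ℕ) (g : Finset ℕ → R) :
    ∑ B ∈ X.powersetCard 4, g B = ∑ a ∈ X, ∑ b ∈ X, ∑ c ∈ X, ∑ d ∈ X,
      if a < b ∧ b < c ∧ c < d then g {a, b, c, d} else 0 := by
  have hmono : ∀ {a b c d : ℕ}, a < b → b < c → c < d → StrictMono ![a, b, c, d] := by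
    intro a b c d h1 h2 h3 i j hij
    fin_cases i <;> fin_cases j <;> simp_all <;> omega
  simp only [← Finset.sum_product']
  rw [← Finset.sum_filter]
  symm
  refine Finset.sum_bij (fun p _ => {p.1, p.2.1, p.2.2.1, p.2.2.2}) ?_ ?_ ?_ ?_
  · rintro ⟨a, b, c, d⟩ hp
    simp only [Finset.mem_filter, Finset.mem_product] at hp
    rw [Finset.mem_powersetCard]
    refine ⟨?_, ?_⟩
    · intro x
      simp only [Finset.mem_insert, Finset.mem_singleton]
      rintro (rfl | rfl | rfl | rfl) <;> tauto
    · rw [Finset.card_insert_of_notMem, Finset.card_insert_of_notMem,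
        Finset.card_insert_of_notMem, Finset.card_singleton] <;> simp <;> omega
  · rintro ⟨a, b, c, d⟩ hp ⟨a', b', c', d'⟩ hp' h
    simp only [Finset.mem_filter, Finset.mem_product] at hp hp' h
    have hcard : ({a, b, c, d} : Finset ℕ).card = 4 := by
      rw [Finset.card_insert_of_notMem, Finset.card_insert_of_notMem,
        Finset.card_insert_of_notMem, Finset.card_singleton] <;> simp <;> omega
    have h1 := Finset.orderEmbOfFin_unique hcard (f := ![a, b, c, d])
      (by intro i; fin_cases i <;> simp) (hmono hp.2.1 hp.2.2.1 hp.2.2.2)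
    have h2 := Finset.orderEmbOfFin_unique hcard (f := ![a', b', c', d'])
      (by intro i; rw [h]; fin_cases i <;> simp) (hmono hp'.2.1 hp'.2.2.1 hp'.2.2.2)
    have h3 := h1.trans h2.symm
    have e0 := congrFun h3 0
    have e1 := congrFun h3 1
    have e2 := congrFun h3 2
    have e3 := congrFun h3 3
    simp only [Matrix.cons_val_zero, Matrix.cons_val_one, Matrix.cons_val] at e0 e1 e2 e3
    rw [e0, e1, e2, e3]
  · intro B hB
    obtain ⟨hBX, hB4⟩ := Finset.mem_powersetCard.1 hB
    let e := B.orderEmbOfFin hB4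
    have hmem : ∀ i, e i ∈ B := fun i => B.orderEmbOfFin_mem hB4 i
    refine ⟨⟨e 0, e 1, e 2, e 3⟩, ?_, ?_⟩
    · simp only [Finset.mem_filter, Finset.mem_product]
      refine ⟨⟨hBX (hmem _), hBX (hmem _), hBX (hmem _), hBX (hmem _)⟩, ?_, ?_, ?_⟩ <;>
      · refine e.strictMono ?_
        decide
    · ext x
      have h1 : x ∈ B ↔ x ∈ Set.range e := by
        rw [Finset.range_orderEmbOfFin]
        rfl
      rw [h1]
      simp [Fin.exists_fin_succ, eq_comm]
  · rintro ⟨a, b, c, d⟩ hp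
    rfl

/-! ### Subsets of `{0, …, 15}` as base 256 numbers, so that one arithmetic operation treats all `z`
at once. -/

section Digits

/-- The number with the digits `f 0, …, f (k - 1)` to the base `256`, lowest first. -/
def packDigits (f : ℕ → ℕ) : ℕ → ℕ
  | 0 => 0
  | k + 1 => Nat.add (f 0) (Nat.mul 256 (packDigits (fun z => f (z + 1)) k))

theorem packDigits_succ (f : ℕ → ℕ) (k : ℕ) :
    packDigits f (k + 1) = f 0 + 256 * packDigits (fun z => f (z + 1)) k := rfl

theorem testBit_packDigits {f : ℕ → ℕ} (hf : ∀ z, f z < 256) (k z i : ℕ) (hi : i < 8) :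
    (packDigits f k).testBit (8 * z + i) = (decide (z < k) && (f z).testBit i) := by
  induction k generalizing f z with
  | zero => simp [packDigits]
  | succ k ih =>
    rw [packDigits_succ, add_comm, show (256 : ℕ) = 2 ^ 8 from rfl,
      Nat.testBit_two_pow_mul_add _ (hf 0)]
    cases z with
    | zero => simp [hi]
    | succ z =>
      rw [if_neg (by omega), show 8 * (z + 1) + i - 8 = 8 * z + i by omega,
        ih (fun z => hf (z + 1))]
      simp

theorem eq_of_testBit_eq_of_mul_add {x y : ℕ}
    (h : ∀ z i, i < 8 → x.testBit (8 * z + i) = y.testBit (8 * z + i)) : x = y := by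
  refine Nat.eq_of_testBit_eq fun j => ?_
  have := h (j / 8) (j % 8) (Nat.mod_lt _ (by norm_num))
  rwa [Nat.div_add_mod] at this

theorem packDigits_congr {f g : ℕ → ℕ} (k : ℕ) (h : ∀ z < k, f z = g z) :
    packDigits f k = packDigits g k := by
  induction k generalizing f g with
  | zero => rfl
  | succ k ih =>
    rw [packDigits_succ, packDigits_succ, h 0 (by omega), ih fun z hz => h (z + 1) (by omega)]

theorem packDigits_add (f g : ℕ → ℕ) (k : ℕ) :
    packDigits f k + packDigits g k = packDigits (fun z => f z + g z) k := by
  induction k generalizing f g with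
  | zero => rfl
  | succ k ih =>
    rw [packDigits_succ, packDigits_succ, packDigits_succ, ← ih]
    ring

theorem mul_packDigits (c : ℕ) (f : ℕ → ℕ) (k : ℕ) :
    c * packDigits f k = packDigits (fun z => c * f z) k := by
  induction k generalizing f with
  | zero => rfl
  | succ k ih =>
    rw [packDigits_succ, packDigits_succ, ← ih]
    ring

theorem xor_packDigits {f g : ℕ → ℕ} (hf : ∀ z, f z < 256) (hg : ∀ z, g z < 256) (k : ℕ) :
    packDigits f k ^^^ packDigits g k = packDigits (fun z => f z ^^^ g z) k := by
  refine eq_of_testBit_eq_of_mul_add fun z i hi => ?_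
  rw [Nat.testBit_xor, testBit_packDigits hf _ _ _ hi, testBit_packDigits hg _ _ _ hi,
    testBit_packDigits (fun z => Nat.xor_lt_two_pow (n := 8) (hf z) (hg z)) _ _ _ hi,
    Nat.testBit_xor]
  cases decide (z < k) <;> simp

open Classical in
/-- The subset of `{0, …, 15}` given by `p`, as a number with the digits `0` and `1` to the base
`256`. -/
noncomputable def digitMask (p : ℕ → Prop) : ℕ := packDigits (fun z => if p z then 1 else 0) 16

open Classical in
theorem testBit_digitMask (p : ℕ → Prop) (z i : ℕ) (hi : i < 8) :
    (digitMask p).testBit (8 * z + i) = decide (z < 16 ∧ p z ∧ i = 0) := by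
  rw [digitMask, testBit_packDigits (fun z => by split_ifs <;> norm_num) _ _ _ hi]
  by_cases h : p z
  · have h1 : Nat.testBit 1 i = decide (i = 0) := by interval_cases i <;> rfl
    simp [h, h1]
  · simp [h]

theorem digitMask_land (p q : ℕ → Prop) :
    Nat.land (digitMask p) (digitMask q) = digitMask fun z => p z ∧ q z := by
  classical
  refine eq_of_testBit_eq_of_mul_add fun z i hi => ?_
  change (digitMask p &&& digitMask q).testBit _ = _
  rw [Nat.testBit_and, testBit_digitMask _ _ _ hi, testBit_digitMask _ _ _ hi,
    testBit_digitMask _ _ _ hi, ← Bool.decide_and]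
  exact decide_eq_decide.2 (by tauto)

theorem digitMask_lor (p q : ℕ → Prop) :
    Nat.lor (digitMask p) (digitMask q) = digitMask fun z => p z ∨ q z := by
  classical
  refine eq_of_testBit_eq_of_mul_add fun z i hi => ?_
  change (digitMask p ||| digitMask q).testBit _ = _
  rw [Nat.testBit_or, testBit_digitMask _ _ _ hi, testBit_digitMask _ _ _ hi,
    testBit_digitMask _ _ _ hi, ← Bool.decide_or]
  exact decide_eq_decide.2 (by tauto)

theorem digitMask_xor (p q : ℕ → Prop) :
    digitMask p ^^^ digitMask q = digitMask fun z => ¬ (p z ↔ q z) := by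
  classical
  refine eq_of_testBit_eq_of_mul_add fun z i hi => ?_
  rw [Nat.testBit_xor, testBit_digitMask _ _ _ hi, testBit_digitMask _ _ _ hi,
    testBit_digitMask _ _ _ hi]
  by_cases h1 : z < 16 <;> by_cases h2 : i = 0 <;> by_cases h3 : p z <;> by_cases h4 : q z <;>
    simp [h1, h2, h3, h4]

theorem digitMask_eq_iff (p q : ℕ → Prop) :
    digitMask p = digitMask q ↔ ∀ z < 16, (p z ↔ q z) := by
  classical
  constructor
  · intro h z hz
    have h1 := testBit_digitMask p z 0 (by norm_num)
    rw [h, testBit_digitMask q z 0 (by norm_num)] at h1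
    simpa [hz, eq_comm] using h1
  · intro h
    refine packDigits_congr 16 fun z hz => ?_
    simp [h z hz]

open Classical in
-- As `256 ≡ 1` modulo `255`, the remainder is the digit sum, which is at most 16.
theorem digitMask_mod (p : ℕ → Prop) :
    Nat.mod (digitMask p) 255 = ((Finset.range 16).filter p).card := by
  have h : ∀ (f : ℕ → ℕ) (k : ℕ), packDigits f k ≡ ∑ z ∈ Finset.range k, f z [MOD 255] := by
    intro f k
    induction k generalizing f with
    | zero => rfl
    | succ k ih =>
      rw [packDigits_succ, Finset.sum_range_succ', add_comm]
      refine Nat.ModEq.add ?_ rfl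
      have h256 : 256 ≡ 1 [MOD 255] := rfl
      simpa using h256.mul (ih fun z => f (z + 1))
  have h1 := h (fun z => if p z then 1 else 0) 16
  rw [← Finset.card_filter] at h1
  change packDigits _ 16 % 255 = _
  rw [h1]
  refine Nat.mod_eq_of_lt ((Finset.card_filter_le _ _).trans_lt ?_)
  rw [Finset.card_range]
  norm_num

/-- The number with all `16` digits `1`. -/
def unitDigits : ℕ := packDigits (fun _ => 1) 16

theorem unitDigits_eq : unitDigits = digitMask fun _ => True := by
  simp [unitDigits, digitMask]

/-- The set of the places with digit `0` among the lowest `16` places to the base `256`. -/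
def zeroDigits (X : ℕ) : ℕ :=
  let X1 := Nat.lor X (Nat.shiftRight X 4)
  let X2 := Nat.lor X1 (Nat.shiftRight X1 2)
  let X3 := Nat.lor X2 (Nat.shiftRight X2 1)
  Nat.xor unitDigits (Nat.land unitDigits X3)

theorem zeroDigits_eq (X : ℕ) : zeroDigits X = unitDigits ^^^ (unitDigits &&&
    (((X ||| X >>> 4) ||| (X ||| X >>> 4) >>> 2) |||
      ((X ||| X >>> 4) ||| (X ||| X >>> 4) >>> 2) >>> 1)) := rfl

theorem testBits_eq_false_iff : ∀ x < 256, (x.testBit 0 || x.testBit 1 || x.testBit 2 ||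
    x.testBit 3 || x.testBit 4 || x.testBit 5 || x.testBit 6 || x.testBit 7) =
    !decide (x = 0) := by
  decide +kernel

/-- The shifts by 4, 2 and 1 gather the disjunction of the eight bits of each digit in its lowest
bit, and the mask `unitDigits` discards the other bits. -/
theorem zeroDigits_packDigits {h : ℕ → ℕ} (hh : ∀ z, h z < 256) :
    zeroDigits (packDigits h 16) = digitMask fun z => h z = 0 := by
  classical
  rw [zeroDigits_eq]
  set X := packDigits h 16 with hX
  have hland : unitDigits &&& (((X ||| X >>> 4) ||| (X ||| X >>> 4) >>> 2) |||
      ((X ||| X >>> 4) ||| (X ||| X >>> 4) >>> 2) >>> 1) = digitMask fun z => h z ≠ 0 := by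
    refine eq_of_testBit_eq_of_mul_add fun z i hi => ?_
    rw [Nat.testBit_and, unitDigits_eq, testBit_digitMask _ _ _ hi, testBit_digitMask _ _ _ hi]
    by_cases hi0 : i = 0
    · subst hi0
      by_cases hz : z < 16
      · have hb : ∀ j < 8, X.testBit (8 * z + j) = (h z).testBit j := by
          intro j hj
          rw [hX, testBit_packDigits hh _ _ _ hj]
          simp [hz]
        have h0 := hb 0 (by norm_num)
        rw [Nat.add_zero] at h0
        simp only [Nat.testBit_or, Nat.testBit_shiftRight, Nat.add_zero]
        rw [show 4 + 8 * z = 8 * z + 4 by ring, show 2 + 8 * z = 8 * z + 2 by ring,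
          show 1 + 8 * z = 8 * z + 1 by ring, show 4 + (8 * z + 2) = 8 * z + 6 by ring,
          show 4 + (8 * z + 1) = 8 * z + 5 by ring, show 2 + (8 * z + 1) = 8 * z + 3 by ring,
          show 4 + (8 * z + 3) = 8 * z + 7 by ring, h0, hb 1 (by norm_num), hb 2 (by norm_num),
          hb 3 (by norm_num), hb 4 (by norm_num), hb 5 (by norm_num), hb 6 (by norm_num),
          hb 7 (by norm_num)]
        have h2 := testBits_eq_false_iff (h z) (hh z)
        simp only [hz, true_and, and_true, ne_eq, decide_not, decide_true, Bool.true_and]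
        rw [← h2]
        simp only [Bool.or_assoc, Bool.or_left_comm]
      · simp [hz]
    · simp [hi0]
  rw [hland, unitDigits_eq, digitMask_xor]
  refine congrArg digitMask (funext fun z => ?_)
  simp

end Digits

/-! ### Determinants and coordinates shifted to natural numbers. -/

section Codes

/-- `minorThree` plus `3`. -/
def minorCode (b c d i j k : ℕ) : ℕ :=
  Nat.sub (Nat.add (Nat.add (Nat.mul (bitNat b i) (Nat.mul (bitNat c j) (bitNat d k)))
      (Nat.mul (bitNat b j) (Nat.mul (bitNat c k) (bitNat d i))))
      (Nat.add (Nat.mul (bitNat b k) (Nat.mul (bitNat c i) (bitNat d j))) 3))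
    (Nat.add (Nat.add (Nat.mul (bitNat b k) (Nat.mul (bitNat c j) (bitNat d i)))
      (Nat.mul (bitNat b j) (Nat.mul (bitNat c i) (bitNat d k))))
      (Nat.mul (bitNat b i) (Nat.mul (bitNat c k) (bitNat d j))))

/-- The subtracted part is a sum of three products at most 1, so the added 3 keeps the truncated
subtraction exact. -/
theorem minorCode_eq (b c d i j k : ℕ) :
    (minorCode b c d i j k : ℤ) = minorThree b c d i j k + 3 := by
  have h : ∀ i j k, bitNat b i * (bitNat c j * bitNat d k) ≤ 1 := fun i j k => by
    have := Nat.mul_le_mul (bitNat_le_one b i)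
      (Nat.mul_le_mul (bitNat_le_one c j) (bitNat_le_one d k))
    simpa using this
  have h1 := h k j i
  have h2 := h j i k
  have h3 := h i k j
  change ((bitNat b i * (bitNat c j * bitNat d k) + bitNat b j * (bitNat c k * bitNat d i) +
    (bitNat b k * (bitNat c i * bitNat d j) + 3) - (bitNat b k * (bitNat c j * bitNat d i) +
    bitNat b j * (bitNat c i * bitNat d k) + bitNat b i * (bitNat c k * bitNat d j)) : ℕ) : ℤ) = _
  rw [Nat.cast_sub (by omega), minorThree]
  push_cast
  ring

theorem minorCode_le (b c d i j k : ℕ) : minorCode b c d i j k ≤ 6 := by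
  have h : ∀ i j k, bitNat b i * (bitNat c j * bitNat d k) ≤ 1 := fun i j k => by
    have := Nat.mul_le_mul (bitNat_le_one b i)
      (Nat.mul_le_mul (bitNat_le_one c j) (bitNat_le_one d k))
    simpa using this
  have h1 := h i j k
  have h2 := h j k i
  have h3 := h k i j
  change bitNat b i * (bitNat c j * bitNat d k) + bitNat b j * (bitNat c k * bitNat d i) +
    (bitNat b k * (bitNat c i * bitNat d j) + 3) - _ ≤ 6
  omega

/-- `detFour` plus `12`. -/
def detCode (y b c d : ℕ) : ℕ :=
  Nat.sub (Nat.add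
      (Nat.add (Nat.mul (bitNat y 0) (minorCode b c d 1 2 3))
        (Nat.mul (bitNat y 1) (Nat.sub 6 (minorCode b c d 0 2 3))))
      (Nat.add (Nat.mul (bitNat y 2) (minorCode b c d 0 1 3))
        (Nat.add (Nat.mul (bitNat y 3) (Nat.sub 6 (minorCode b c d 0 1 2))) 12)))
    (Nat.mul 3 (Nat.add (Nat.add (bitNat y 0) (bitNat y 1)) (Nat.add (bitNat y 2) (bitNat y 3))))

/-- The four minors lie between -3 and 3, whence the shift `12 = 4 * 3`; `6 - minorCode` is the code
of the negated minor. -/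
theorem detCode_eq_and_le (y b c d : ℕ) :
    (detCode y b c d : ℤ) = detFour y b c d + 12 ∧ detCode y b c d ≤ 24 := by
  have e1 := minorCode_eq b c d 1 2 3
  have e2 := minorCode_eq b c d 0 2 3
  have e3 := minorCode_eq b c d 0 1 3
  have e4 := minorCode_eq b c d 0 1 2
  have l1 := minorCode_le b c d 1 2 3
  have l2 := minorCode_le b c d 0 2 3
  have l3 := minorCode_le b c d 0 1 3
  have l4 := minorCode_le b c d 0 1 2
  have h : detCode y b c d = bitNat y 0 * minorCode b c d 1 2 3 +
      bitNat y 1 * (6 - minorCode b c d 0 2 3) + (bitNat y 2 * minorCode b c d 0 1 3 +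
      (bitNat y 3 * (6 - minorCode b c d 0 1 2) + 12)) -
      3 * (bitNat y 0 + bitNat y 1 + (bitNat y 2 + bitNat y 3)) := rfl
  rw [h, detFour]
  rcases bitNat_eq_zero_or_one y 0 with h0 | h0 <;>
  rcases bitNat_eq_zero_or_one y 1 with h1 | h1 <;>
  rcases bitNat_eq_zero_or_one y 2 with h2 | h2 <;>
  rcases bitNat_eq_zero_or_one y 3 with h3 | h3 <;>
  · simp only [h0, h1, h2, h3, Nat.cast_zero, Nat.cast_one, zero_mul, one_mul]
    omega

/-- `cramerCoords` plus `12`. -/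
def coordCode (a b c d y : ℕ) : ℕ → ℕ
  | 0 => detCode y b c d
  | 1 => Nat.sub 24 (detCode y a c d)
  | 2 => detCode y a b d
  | _ => Nat.sub 24 (detCode y a b c)

theorem coordCode_eq_and_le (a b c d y : ℕ) (l : Fin 4) :
    (coordCode a b c d y l : ℤ) = cramerCoords a b c d y l + 12 ∧ coordCode a b c d y l ≤ 24 := by
  have h0 := detCode_eq_and_le y b c d
  have h1 := detCode_eq_and_le y a c d
  have h2 := detCode_eq_and_le y a b d
  have h3 := detCode_eq_and_le y a b c
  have e1 : coordCode a b c d y 1 = 24 - detCode y a c d := rfl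
  have e3 : coordCode a b c d y 3 = 24 - detCode y a b c := rfl
  fin_cases l
  · exact h0
  · simp only [Fin.mk_one, e1, cramerCoords, Matrix.cons_val_one, Matrix.cons_val_zero]
    omega
  · exact h2
  · change ((24 - detCode y a b c : ℕ) : ℤ) = -detFour y a b c + 12 ∧ 24 - detCode y a b c ≤ 24
    omega

/-- The digits `0` and `1` of the numbers `0, …, 15` at the binary place `l`. -/
def digitPattern (l : ℕ) : ℕ := packDigits (fun z => bitNat z l) 16

/-- The sums of `x, y, z, w` over all subsets of the four places, plus `o`, as base `256` digits. -/
def subsetSumDigits (x y z w o : ℕ) : ℕ :=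
  Nat.add (Nat.add (Nat.mul x (digitPattern 0)) (Nat.mul y (digitPattern 1)))
    (Nat.add (Nat.mul z (digitPattern 2))
      (Nat.add (Nat.mul w (digitPattern 3)) (Nat.mul o unitDigits)))

theorem subsetSumDigits_eq (x y z w o : ℕ) :
    subsetSumDigits x y z w o = packDigits (fun t => x * bitNat t 0 + y * bitNat t 1 +
      (z * bitNat t 2 + (w * bitNat t 3 + o * 1))) 16 := by
  change x * digitPattern 0 + y * digitPattern 1 + (z * digitPattern 2 +
    (w * digitPattern 3 + o * unitDigits)) = _
  simp only [digitPattern, unitDigits, mul_packDigits, packDigits_add]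

/-- The set of subsets of the coordinates of `y` with sum `o - 12`, as a mask. -/
def coordSumMask (a b c d y o : ℕ) : ℕ :=
  zeroDigits (Nat.xor (subsetSumDigits (coordCode a b c d y 0) (coordCode a b c d y 1)
    (coordCode a b c d y 2) (coordCode a b c d y 3) 12) (subsetSumDigits 12 12 12 12 o))

/-- Each chosen place contributes the same shift 12 to both compared digits, so they agree exactly
when the coordinate sum plus 12 is `o`. All digits are at most `4 * 24 + 24 = 120`, so nothing is
carried. -/
theorem coordSumMask_eq (a b c d y o : ℕ) (ho : o ≤ 24) :
    coordSumMask a b c d y o = digitMask fun z =>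
      ∑ l : Fin 4, bitNat z l * cramerCoords a b c d y l = (o : ℤ) - 12 := by
  have h0 := coordCode_eq_and_le a b c d y 0
  have h1 := coordCode_eq_and_le a b c d y 1
  have h2 := coordCode_eq_and_le a b c d y 2
  have h3 := coordCode_eq_and_le a b c d y 3
  simp only [Fin.val_zero, Fin.val_one, Fin.val_two,
    show ((3 : Fin 4) : ℕ) = 3 from rfl] at h0 h1 h2 h3
  rw [coordSumMask, subsetSumDigits_eq, subsetSumDigits_eq]
  have hlt : ∀ x y z w o : ℕ, x ≤ 24 → y ≤ 24 → z ≤ 24 → w ≤ 24 → o ≤ 24 → ∀ t,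
      x * bitNat t 0 + y * bitNat t 1 + (z * bitNat t 2 + (w * bitNat t 3 + o * 1)) < 256 := by
    intro x y z w o hx hy hz hw ho t
    have b0 := Nat.mul_le_mul hx (bitNat_le_one t 0)
    have b1 := Nat.mul_le_mul hy (bitNat_le_one t 1)
    have b2 := Nat.mul_le_mul hz (bitNat_le_one t 2)
    have b3 := Nat.mul_le_mul hw (bitNat_le_one t 3)
    omega
  have hA := hlt _ _ _ _ 12 h0.2 h1.2 h2.2 h3.2 (by norm_num)
  have hB := hlt 12 12 12 12 o (by norm_num) (by norm_num) (by norm_num) (by norm_num) ho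
  change zeroDigits (packDigits _ 16 ^^^ packDigits _ 16) = _
  rw [xor_packDigits hA hB, zeroDigits_packDigits
    (fun z => Nat.xor_lt_two_pow (n := 8) (hA z) (hB z)), digitMask_eq_iff]
  intro t _
  rw [Nat.xor_eq_zero_iff, Fin.sum_univ_four]
  simp only [Fin.val_zero, Fin.val_one, Fin.val_two, show ((3 : Fin 4) : ℕ) = 3 from rfl]
  rcases bitNat_eq_zero_or_one t 0 with b0 | b0 <;>
  rcases bitNat_eq_zero_or_one t 1 with b1 | b1 <;>
  rcases bitNat_eq_zero_or_one t 2 with b2 | b2 <;>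
  rcases bitNat_eq_zero_or_one t 3 with b3 | b3 <;>
  · simp only [b0, b1, b2, b3, Nat.cast_zero, Nat.cast_one, zero_mul, one_mul]
    omega

end Codes

/-! ### Formal sums of homogeneous sums, and the alternating sum over `U`. -/

section Tally

/-- A formal combination of natural numbers (the keys) with natural coefficients. -/
abbrev Tally := List (ℕ × ℕ)

/-- Adds `a :: l` to a formal combination, where `f` adds `l`. -/
def mergeTallyAux (a : ℕ × ℕ) (l : Tally) (f : Tally → Tally) : Tally → Tally
  | [] => a :: l
  | b :: l' =>
    bif Nat.blt a.1 b.1 then a :: f (b :: l')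
    else bif Nat.beq a.1 b.1 then (a.1, Nat.add a.2 b.2) :: f l'
    else b :: mergeTallyAux a l f l'

/-- The sum of two formal combinations; the keys are increasing if they are in both. -/
def mergeTally : Tally → Tally → Tally
  | [], l' => l'
  | a :: l, l' => mergeTallyAux a l (mergeTally l) l'

/-- The sum of a list of formal combinations. -/
def sumTally (f : ℕ → Tally) : List ℕ → Tally
  | [] => []
  | a :: l => mergeTally (f a) (sumTally f l)

/-- The value of a formal combination under a function of the keys. -/
def evalTally (F : ℕ → ℤ) (t : Tally) : ℤ := (t.map fun p => (p.2 : ℤ) * F p.1).sum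

theorem evalTally_cons (F : ℕ → ℤ) (p : ℕ × ℕ) (t : Tally) :
    evalTally F (p :: t) = p.2 * F p.1 + evalTally F t := by
  simp [evalTally]

theorem evalTally_mergeTally (F : ℕ → ℤ) (t t' : Tally) :
    evalTally F (mergeTally t t') = evalTally F t + evalTally F t' := by
  induction t generalizing t' with
  | nil => simp [mergeTally, evalTally]
  | cons a l ih =>
    rw [mergeTally]
    induction t' with
    | nil => simp [mergeTallyAux, evalTally]
    | cons b l' ih' =>
      rw [mergeTallyAux]
      cases h1 : Nat.blt a.1 b.1
      · cases h2 : Nat.beq a.1 b.1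
        · simp only [cond_false, evalTally_cons, ih']
          ring
        · have h3 : a.1 = b.1 := Nat.eq_of_beq_eq_true h2
          simp only [cond_false, cond_true, evalTally_cons, ih, h3, Nat.add_eq, Nat.cast_add]
          ring
      · simp only [cond_true, evalTally_cons, ih]
        ring

theorem evalTally_sumTally (F : ℕ → ℤ) (f : ℕ → Tally) (l : List ℕ) :
    evalTally F (sumTally f l) = (l.map fun a => evalTally F (f a)).sum := by
  induction l with
  | nil => rfl
  | cons a l ih => rw [sumTally, evalTally_mergeTally, ih, List.map_cons, List.sum_cons]

/-- The key of a mask `D` with sign `s`: the sizes of `D ∩ q1`, `D ∩ q2`, `D ∩ q3` and `D`. -/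
def leafKey (q1 q2 q3 D s : ℕ) : ℕ :=
  Nat.add (Nat.mul 2 (Nat.add (Nat.mul (Nat.add (Nat.mul (Nat.add
    (Nat.mul (Nat.mod (Nat.land D q1) 255) 17) (Nat.mod (Nat.land D q2) 255)) 17)
    (Nat.mod (Nat.land D q3) 255)) 17) (Nat.mod D 255))) s

/-- The alternating sum over all subsets of the given masks of the key of the intersection. -/
def subsetTally (q1 q2 q3 : ℕ) : List ℕ → ℕ → ℕ → Tally
  | [], D, s => [(leafKey q1 q2 q3 D s, 1)]
  -- If `m` contains `D`, the subsets with and without `m` cancel in pairs. The sign is kept in the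
  -- key because the coefficients are natural numbers.
  | m :: l, D, s => bif Nat.beq (Nat.land D m) D then [] else
      mergeTally (subsetTally q1 q2 q3 l D s) (subsetTally q1 q2 q3 l (Nat.land D m) (Nat.sub 1 s))

/-- The arguments of the homogeneous sum given by a key. -/
def keyCounts (k : ℕ) : ℕ → ℤ
  | 0 => 1
  | 1 => (k / 4913 : ℕ)
  | 2 => (k / 289 % 17 : ℕ)
  | 3 => (k / 17 % 17 : ℕ)
  | _ => (k % 17 : ℕ)

/-- The signed homogeneous sum given by a key. -/
def keyValue (n k : ℕ) : ℤ :=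
  (if k % 2 = 0 then 1 else -1) * homogeneousSum (keyCounts (k / 2)) n 4

open Classical in
/-- The numbers of `z < 16` with `p z` that satisfy no, or one of three, further conditions. -/
noncomputable def levelCounts (q1 q2 q3 p : ℕ → Prop) : ℕ → ℤ
  | 0 => 1
  | 1 => ((Finset.range 16).filter fun z => p z ∧ q1 z).card
  | 2 => ((Finset.range 16).filter fun z => p z ∧ q2 z).card
  | 3 => ((Finset.range 16).filter fun z => p z ∧ q3 z).card
  | _ => ((Finset.range 16).filter p).card

theorem levelCounts_congr (q1 q2 q3 : ℕ → Prop) {p p' : ℕ → Prop} (h : ∀ z < 16, (p z ↔ p' z)) :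
    levelCounts q1 q2 q3 p = levelCounts q1 q2 q3 p' := by
  classical
  have hf : ∀ q : ℕ → Prop, ((Finset.range 16).filter fun z => p z ∧ q z) =
      (Finset.range 16).filter fun z => p' z ∧ q z := by
    intro q
    refine Finset.filter_congr fun z hz => ?_
    rw [h z (Finset.mem_range.1 hz)]
  have h4 : (Finset.range 16).filter p = (Finset.range 16).filter p' :=
    Finset.filter_congr fun z hz => h z (Finset.mem_range.1 hz)
  funext j
  match j with
  | 0 => rfl
  | 1 => simp only [levelCounts, hf]
  | 2 => simp only [levelCounts, hf]
  | 3 => simp only [levelCounts, hf]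
  | _ + 4 => simp only [levelCounts, h4]

/-- The counts are at most 16, so they can be recovered as base 17 digits, above the sign in the
lowest binary digit. -/
theorem keyValue_leafKey (n : ℕ) (q1 q2 q3 p : ℕ → Prop) (s : ℕ) (hs : s ≤ 1) :
    keyValue n (leafKey (digitMask q1) (digitMask q2) (digitMask q3) (digitMask p) s) =
      (-1) ^ s * homogeneousSum (levelCounts q1 q2 q3 p) n 4 := by
  classical
  have hle : ∀ (q : ℕ → Prop) (_ : DecidablePred q), ((Finset.range 16).filter q).card < 17 := by
    intro q _
    refine (Finset.card_filter_le _ _).trans_lt ?_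
    rw [Finset.card_range]
    norm_num
  have hkey : leafKey (digitMask q1) (digitMask q2) (digitMask q3) (digitMask p) s =
      2 * (((((Finset.range 16).filter fun z => p z ∧ q1 z).card * 17 +
        ((Finset.range 16).filter fun z => p z ∧ q2 z).card) * 17 +
        ((Finset.range 16).filter fun z => p z ∧ q3 z).card) * 17 +
        ((Finset.range 16).filter p).card) + s := by
    rw [leafKey, digitMask_land, digitMask_land, digitMask_land, digitMask_mod, digitMask_mod,
      digitMask_mod, digitMask_mod]
    simp only [Nat.add_eq, Nat.mul_eq]
    congr!
  rw [hkey, keyValue]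
  generalize hn1 : ((Finset.range 16).filter fun z => p z ∧ q1 z).card = n1
  generalize hn2 : ((Finset.range 16).filter fun z => p z ∧ q2 z).card = n2
  generalize hn3 : ((Finset.range 16).filter fun z => p z ∧ q3 z).card = n3
  generalize hn4 : ((Finset.range 16).filter p).card = n4
  have h1 : n1 < 17 := hn1 ▸ hle _ _
  have h2 : n2 < 17 := hn2 ▸ hle _ _
  have h3 : n3 < 17 := hn3 ▸ hle _ _
  have h4 : n4 < 17 := hn4 ▸ hle _ _
  congr 1
  · interval_cases s <;> simp [Nat.add_mod]
  · rw [show (2 * (((n1 * 17 + n2) * 17 + n3) * 17 + n4) + s) / 2 =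
      ((n1 * 17 + n2) * 17 + n3) * 17 + n4 by omega]
    refine homogeneousSum_congr n 4 fun j hj => ?_
    interval_cases j
    · rfl
    · rw [keyCounts, levelCounts, show (((n1 * 17 + n2) * 17 + n3) * 17 + n4) / 4913 = n1 by omega,
        ← hn1]
    · rw [keyCounts, levelCounts,
        show (((n1 * 17 + n2) * 17 + n3) * 17 + n4) / 289 % 17 = n2 by omega, ← hn2]
    · rw [keyCounts, levelCounts,
        show (((n1 * 17 + n2) * 17 + n3) * 17 + n4) / 17 % 17 = n3 by omega, ← hn3]
    · change (((((n1 * 17 + n2) * 17 + n3) * 17 + n4) % 17 : ℕ) : ℤ) =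
        (((Finset.range 16).filter p).card : ℤ)
      rw [show (((n1 * 17 + n2) * 17 + n3) * 17 + n4) % 17 = n4 by omega, ← hn4]

theorem evalTally_subsetTally (n : ℕ) (q1 q2 q3 : ℕ → Prop) (m : ℕ → ℕ → Prop) (l : List ℕ)
    (hl : l.Nodup) (p : ℕ → Prop) (s : ℕ) (hs : s ≤ 1) :
    evalTally (keyValue n) (subsetTally (digitMask q1) (digitMask q2) (digitMask q3)
      (l.map fun y => digitMask (m y)) (digitMask p) s) =
      (-1) ^ s * ∑ U ∈ l.toFinset.powerset, (-1) ^ U.card *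
        homogeneousSum (levelCounts q1 q2 q3 fun z => p z ∧ ∀ u ∈ U, m u z) n 4 := by
  induction l generalizing p s with
  | nil =>
    rw [List.map_nil, subsetTally, evalTally_cons, keyValue_leafKey _ _ _ _ _ _ hs]
    simp [evalTally]
  | cons a l ih =>
    have ha : a ∉ l.toFinset := by simpa using (List.nodup_cons.1 hl).1
    have hl' := (List.nodup_cons.1 hl).2
    rw [List.map_cons, subsetTally, digitMask_land, List.toFinset_cons,
      Finset.sum_powerset_insert ha]
    have h2 : ∀ U ∈ l.toFinset.powerset, (-1 : ℤ) ^ (insert a U).card *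
        homogeneousSum (levelCounts q1 q2 q3 fun z => p z ∧ ∀ u ∈ insert a U, m u z) n 4 =
        -((-1) ^ U.card * homogeneousSum (levelCounts q1 q2 q3
          fun z => (p z ∧ m a z) ∧ ∀ u ∈ U, m u z) n 4) := by
      intro U hU
      have haU : a ∉ U := fun h => ha (Finset.mem_powerset.1 hU h)
      have h3 : (fun z => p z ∧ ∀ u ∈ insert a U, m u z) =
          fun z => (p z ∧ m a z) ∧ ∀ u ∈ U, m u z := by
        funext z
        rw [Finset.forall_mem_insert, and_assoc]
      rw [h3, Finset.card_insert_of_notMem haU]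
      ring
    rw [Finset.sum_congr rfl h2, Finset.sum_neg_distrib]
    cases hb : Nat.beq (digitMask fun z => p z ∧ m a z) (digitMask p)
    · rw [cond_false, evalTally_mergeTally, ih hl' p s hs, Nat.sub_eq, ih hl' _ (1 - s) (by omega)]
      have h4 : (-1 : ℤ) ^ (1 - s) = -(-1) ^ s := by interval_cases s <;> simp
      rw [h4]
      ring
    · rw [cond_true]
      have h4 := (digitMask_eq_iff _ _).1 (Nat.eq_of_beq_eq_true hb)
      have h5 : ∀ U : Finset ℕ, levelCounts q1 q2 q3 (fun z => (p z ∧ m a z) ∧ ∀ u ∈ U, m u z) =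
          levelCounts q1 q2 q3 fun z => p z ∧ ∀ u ∈ U, m u z := fun U =>
        levelCounts_congr _ _ _ fun z hz => by rw [h4 z hz]
      simp only [h5]
      simp [evalTally]

end Tally

/-! ### The contribution of one greedy basis, and the sum over all of them. -/

section BasisTally

/-- The test for the span of the vectors of `a, b, c, d` that are earlier than `y`. -/
def inEarlierSpan (a b c d y : ℕ) : Bool :=
  (Nat.blt a y || Nat.beq (coordCode a b c d y 0) 12) &&
  (Nat.blt b y || Nat.beq (coordCode a b c d y 1) 12) &&
  (Nat.blt c y || Nat.beq (coordCode a b c d y 2) 12) &&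
  (Nat.blt d y || Nat.beq (coordCode a b c d y 3) 12)

/-- The codes of the nonempty subsets of a four-element set. -/
def nonzeroCodes : List ℕ := [1, 2, 3, 4, 5, 6, 7, 8, 9, 10, 11, 12, 13, 14, 15]

/-- The contribution of the spanning sets with the leading basis `a, b, c, d`. -/
def basisTally (a b c d : ℕ) : Tally :=
  bif Nat.beq (detCode a b c d) 12 then [] else
  -- Here `1`, `2`, `4` code the first three unit vectors and `12` codes the value zero: `q3`, `q2`,
  -- `q1` are the forms whose first one, two, three coefficients vanish, that is, forms in the last
  -- three, two, one coordinates.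
  let q3 := coordSumMask a b c d 1 12
  let q2 := Nat.land q3 (coordSumMask a b c d 2 12)
  let q1 := Nat.land q2 (coordSumMask a b c d 4 12)
  subsetTally q1 q2 q3 ((nonzeroCodes.filter (inEarlierSpan a b c d)).map fun y =>
      Nat.lor (coordSumMask a b c d y 12) (coordSumMask a b c d y (detCode a b c d)))
    unitDigits 0

/-- The contribution of all spanning sets. -/
def spanningTally : Tally :=
  sumTally (fun a => sumTally (fun b => sumTally (fun c => sumTally (fun d =>
    bif Nat.blt a b && (Nat.blt b c && Nat.blt c d) then basisTally a b c d else [])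
    nonzeroCodes) nonzeroCodes) nonzeroCodes) nonzeroCodes

theorem inEarlierSpan_iff (a b c d y : ℕ) : inEarlierSpan a b c d y = true ↔
    ∀ l, (![a, b, c, d] : Fin 4 → ℕ) l < y ∨ cramerCoords a b c d y l = 0 := by
  have h : ∀ (x : ℕ) (l : Fin 4), (Nat.blt x y || Nat.beq (coordCode a b c d y l) 12) = true ↔
      x < y ∨ cramerCoords a b c d y l = 0 := by
    intro x l
    have h1 := (coordCode_eq_and_le a b c d y l).1
    rw [Bool.or_eq_true, Nat.blt_eq, Nat.beq_eq]
    refine or_congr Iff.rfl ?_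
    omega
  rw [inEarlierSpan, Bool.and_eq_true, Bool.and_eq_true, Bool.and_eq_true, and_assoc, and_assoc]
  have h0 := h a 0
  have h1 := h b 1
  have h2 := h c 2
  have h3 := h d 3
  constructor
  · rintro ⟨g0, g1, g2, g3⟩ l
    fin_cases l
    · exact h0.1 g0
    · exact h1.1 g1
    · exact h2.1 g2
    · exact h3.1 g3
  · intro g
    exact ⟨h0.2 (g 0), h1.2 (g 1), h2.2 (g 2), h3.2 (g 3)⟩

theorem toFinset_nonzeroCodes : nonzeroCodes.toFinset = Finset.Icc 1 15 := by decide

theorem nodup_nonzeroCodes : nonzeroCodes.Nodup := by decide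

theorem zeroOneFormCount_zero (K : Type*) [Field K] {r : ℕ} (T : Finset (Finset (Fin r))) :
    zeroOneFormCount K T 0 = 1 := by
  rw [zeroOneFormCount, Nat.cast_eq_one, Nat.card_eq_one_iff_unique]
  refine ⟨⟨fun c c' => ?_⟩, ⟨⟨0, by simp, by simp⟩⟩⟩
  ext i
  rw [c.2.1 i (by simp), c'.2.1 i (by simp)]

theorem forall_fin_four_add_one_lt (P : Fin 4 → Prop) :
    (∀ i : Fin 4, (i : ℕ) + 1 < 4 → P i) ↔ (P 0 ∧ P 1) ∧ P 2 := by
  simp [Fin.forall_fin_succ, and_assoc]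

theorem forall_fin_four_add_two_lt (P : Fin 4 → Prop) :
    (∀ i : Fin 4, (i : ℕ) + 2 < 4 → P i) ↔ P 0 ∧ P 1 := by
  simp [Fin.forall_fin_succ]

theorem forall_fin_four_add_three_lt (P : Fin 4 → Prop) :
    (∀ i : Fin 4, (i : ℕ) + 3 < 4 → P i) ↔ P 0 := by
  simp [Fin.forall_fin_succ]

open Classical in
theorem evalTally_basisTally (K : Type*) [Field K] [CharZero K] (n : ℕ) {a b c d : ℕ}
    (hab : a < b) (hbc : b < c) (hcd : c < d) :
    evalTally (keyValue n) (basisTally a b c d) =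
      if LinearIndepOn K (bitVec K) (({a, b, c, d} : Finset ℕ) : Set ℕ) ∧
        Submodule.span K (bitVec K '' (({a, b, c, d} : Finset ℕ) : Set ℕ)) = ⊤ then
        ∑ U ∈ ((Finset.Icc 1 15).filter fun u => bitVec K u ∈ Submodule.span K
          (bitVec K '' {s | s ∈ ({a, b, c, d} : Finset ℕ) ∧ s < u})).powerset,
          (-1) ^ ({a, b, c, d} ∪ U : Finset ℕ).card *
            homogeneousSum (zeroOneFormCount K (({a, b, c, d} ∪ U : Finset ℕ).image bitSet)) n 4
      else 0 := by
  have hB : ({a, b, c, d} : Finset ℕ) = Finset.univ.image ![a, b, c, d] := by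
    ext x
    simp [Fin.exists_fin_succ, eq_comm]
  have hcard : ({a, b, c, d} : Finset ℕ).card = 4 := by
    rw [Finset.card_insert_of_notMem, Finset.card_insert_of_notMem,
      Finset.card_insert_of_notMem, Finset.card_singleton] <;> simp <;> omega
  have hdet := detCode_eq_and_le a b c d
  have hC := isScaledCoordinates_cramerCoords a b c d
  rw [basisTally]
  by_cases hD : detFour a b c d = 0
  · have h1 : Nat.beq (detCode a b c d) 12 = true := by
      rw [Nat.beq_eq]
      omega
    rw [h1, cond_true, if_neg]
    · rfl
    · rintro ⟨h2, -⟩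
      refine detFour_ne_zero (K := K) hab hbc hcd ?_ hD
      simpa using h2
  · have h1 : Nat.beq (detCode a b c d) 12 = false := by
      rw [Bool.eq_false_iff, ne_eq, Nat.beq_eq]
      omega
    have hli := hC.linearIndepOn (K := K) hD
    rw [h1, cond_false, if_pos (by rw [hB]; exact ⟨hli, hC.span_eq_top hD⟩)]
    have hallowed : ((Finset.Icc 1 15).filter fun u => bitVec K u ∈ Submodule.span K
        (bitVec K '' {s | s ∈ ({a, b, c, d} : Finset ℕ) ∧ s < u})) =
        (nonzeroCodes.filter (inEarlierSpan a b c d)).toFinset := by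
      ext u
      rw [Finset.mem_filter, List.mem_toFinset, List.mem_filter, inEarlierSpan_iff, hB,
        hC.bitVec_mem_span_iff hD, ← toFinset_nonzeroCodes, List.mem_toFinset]
    set q : Fin 4 → ℕ → Prop := fun i z =>
      ∑ l : Fin 4, bitNat z l * cramerCoords a b c d (2 ^ (i : ℕ)) l = 0 with hq
    have hmask : ∀ y, coordSumMask a b c d y 12 = digitMask fun z =>
        ∑ l : Fin 4, bitNat z l * cramerCoords a b c d y l = 0 := by
      intro y
      rw [coordSumMask_eq _ _ _ _ _ _ (by norm_num)]
      simp
    have hmaskD : ∀ y, coordSumMask a b c d y (detCode a b c d) = digitMask fun z =>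
        ∑ l : Fin 4, bitNat z l * cramerCoords a b c d y l = detFour a b c d := by
      intro y
      rw [coordSumMask_eq _ _ _ _ _ _ hdet.2, hdet.1]
      simp
    have hq3 : coordSumMask a b c d 1 12 = digitMask (q 0) := hmask 1
    have hq2 : coordSumMask a b c d 2 12 = digitMask (q 1) := hmask 2
    have hq1 : coordSumMask a b c d 4 12 = digitMask (q 2) := hmask 4
    simp only [hmask 1, hmask 2, hmask 4] at hq1 hq2 hq3
    simp only [hmask, hmaskD, digitMask_lor, hq1, hq2, hq3, digitMask_land, unitDigits_eq]
    rw [evalTally_subsetTally n _ _ _ (fun y z =>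
      ∑ l : Fin 4, bitNat z l * cramerCoords a b c d y l = 0 ∨
      ∑ l : Fin 4, bitNat z l * cramerCoords a b c d y l = detFour a b c d) _
      (nodup_nonzeroCodes.filter _) _ 0 (by norm_num), pow_zero, one_mul, hallowed]
    refine Finset.sum_congr rfl fun U hU => ?_
    have hdisj : Disjoint ({a, b, c, d} : Finset ℕ) U := by
      refine Finset.disjoint_left.2 fun u hu huU => ?_
      have h3 := Finset.mem_powerset.1 hU huU
      rw [← hallowed] at h3
      rw [hB] at hu h3
      exact notMem_span_lt_of_linearIndepOn hli hu (Finset.mem_filter.1 h3).2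
    -- The basis has four members, so the sign of `B ∪ U` is that of `U`.
    rw [Finset.card_union_of_disjoint hdisj, hcard, pow_add,
      show (-1 : ℤ) ^ 4 = 1 by norm_num, one_mul]
    refine congrArg ((-1 : ℤ) ^ U.card * ·) ?_
    refine homogeneousSum_congr n 4 fun j hj => ?_
    have hcount := hC.zeroOneFormCount_eq (K := K) hD U j
    rw [← hB] at hcount
    interval_cases j
    · rw [zeroOneFormCount_zero, levelCounts]
    all_goals
      rw [hcount, levelCounts]
      refine congrArg (fun s : Finset ℕ => (s.card : ℤ)) ?_
      ext z
      simp only [Finset.mem_filter, true_and]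
      refine and_congr Iff.rfl (Iff.symm ?_)
    · exact (and_congr_left fun _ => forall_fin_four_add_one_lt (q · z)).trans and_comm
    · exact (and_congr_left fun _ => forall_fin_four_add_two_lt (q · z)).trans and_comm
    · exact (and_congr_left fun _ => forall_fin_four_add_three_lt (q · z)).trans and_comm
    · exact and_iff_right fun i (hi : (i : ℕ) + 4 < 4) => absurd hi (by omega)
    all_goals norm_num

open Classical in
/-- The sum over all spanning families of subsets of a four-element set, as a computed tally. -/
theorem sum_spanning_families_eq_evalTally (K : Type*) [Field K] [CharZero K] (n : ℕ) :
    (∑ T : Finset (Finset (Fin 4)),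
      if (∀ I ∈ T, I.Nonempty) ∧ familyRank K T = 4 then
        (-1 : ℤ) ^ T.card * homogeneousSum (zeroOneFormCount K T) n 4 else 0) =
      evalTally (keyValue n) spanningTally := by
  rw [sum_families_four_eq (K := K) fun T =>
    (-1 : ℤ) ^ T.card * homogeneousSum (zeroOneFormCount K T) n 4]
  have hcard : ∀ T ∈ (Finset.Icc 1 15).powerset, (T.image bitSet).card = T.card := fun T hT =>
    Finset.card_image_of_injOn (bitSet_injOn.mono (by exact_mod_cast Finset.mem_powerset.1 hT))
  have h1 : (∑ T ∈ (Finset.Icc 1 15).powerset,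
      if Submodule.span K (bitVec K '' (T : Set ℕ)) = ⊤ then (-1 : ℤ) ^ (T.image bitSet).card *
        homogeneousSum (zeroOneFormCount K (T.image bitSet)) n 4 else 0) =
      ∑ T ∈ (Finset.Icc 1 15).powerset,
      if Submodule.span K (bitVec K '' (T : Set ℕ)) = ⊤ then (-1 : ℤ) ^ T.card *
        homogeneousSum (zeroOneFormCount K (T.image bitSet)) n 4 else 0 :=
    Finset.sum_congr rfl fun T hT => by rw [hcard T hT]
  rw [h1, sum_spanning_eq_sum_leadingBasis (bitVec K) (Finset.Icc 1 15)
    fun T => (-1 : ℤ) ^ T.card * homogeneousSum (zeroOneFormCount K (T.image bitSet)) n 4]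
  -- A basis has four members, so the sum over `B` may run over increasing quadruples.
  have h2 : ∀ B : Finset ℕ, LinearIndepOn K (bitVec K) (B : Set ℕ) ∧
      Submodule.span K (bitVec K '' (B : Set ℕ)) = ⊤ → B.card = 4 := by
    rintro B ⟨hB1, hB2⟩
    have h3 := finrank_span_eq_card (R := K) (b := fun x : B => bitVec K x) hB1
    have h4 : Set.range (fun x : B => bitVec K x) = bitVec K '' (B : Set ℕ) := by
      ext v
      simp
    rw [h4, hB2] at h3
    simpa using h3.symm
  have hsub : (Finset.Icc 1 15).powersetCard 4 ⊆ (Finset.Icc 1 15 : Finset ℕ).powerset :=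
    fun B hB => Finset.mem_powerset.2 (Finset.mem_powersetCard.1 hB).1
  rw [← Finset.sum_subset hsub, sum_powersetCard_four]
  · have hlist : ∀ f : ℕ → ℤ, (nonzeroCodes.map f).sum = ∑ x ∈ Finset.Icc 1 15, f x := by
      intro f
      rw [← toFinset_nonzeroCodes, List.sum_toFinset _ nodup_nonzeroCodes]
    simp only [spanningTally, evalTally_sumTally, hlist]
    refine Finset.sum_congr rfl fun a _ => Finset.sum_congr rfl fun b _ =>
      Finset.sum_congr rfl fun c _ => Finset.sum_congr rfl fun d _ => ?_
    by_cases h : a < b ∧ b < c ∧ c < d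
    · have h3 : (Nat.blt a b && (Nat.blt b c && Nat.blt c d)) = true := by
        simpa [Nat.blt_eq] using h
      rw [if_pos h, h3, cond_true, evalTally_basisTally K n h.1 h.2.1 h.2.2]
    · have h3 : (Nat.blt a b && (Nat.blt b c && Nat.blt c d)) = false := by
        rw [Bool.eq_false_iff]
        simpa [Nat.blt_eq] using h
      rw [if_neg h, h3]
      rfl
  · intro B hB hB4
    refine if_neg fun h => hB4 (Finset.mem_powersetCard.2 ⟨Finset.mem_powerset.1 hB, h2 B h⟩)

end BasisTally

/-! ### Complete homogeneous sums as combinations of powers. -/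

section ClosedForm

/-- The recursion convolves the powers of `d (r + 1)` with those of each `d i`, which gives a
geometric sum with quotient form `(d i ^ n - d (r + 1) ^ n) / (d i - d (r + 1))`. -/
theorem homogeneousSum_succ_eq {R : Type*} [Field R] (d : ℕ → R) (r : ℕ) (w : ℕ → R)
    (h : ∀ n, homogeneousSum d n r = ∑ i ∈ Finset.range (r + 1), w i * d i ^ n)
    (hd : ∀ i ∈ Finset.range (r + 1), d i - d (r + 1) ≠ 0) (n : ℕ) :
    homogeneousSum d n (r + 1) = ∑ i ∈ Finset.range (r + 1),
      w i / (d i - d (r + 1)) * (d i ^ n - d (r + 1) ^ n) := by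
  induction n with
  | zero => simp [homogeneousSum]
  | succ n ih =>
    rw [homogeneousSum, ih, h, Finset.mul_sum, ← Finset.sum_add_distrib]
    refine Finset.sum_congr rfl fun i hi => ?_
    have := hd i hi
    field_simp
    ring

/-- The complete homogeneous polynomial in five distinct elements, as a divided difference. -/
theorem homogeneousSum_four_eq {R : Type*} [Field R] (x : ℕ → R)
    (h : ∀ i j, i < j → j ≤ 4 → x i - x j ≠ 0) (n : ℕ) :
    homogeneousSum x n 4 =
      x 0 ^ n / ((x 0 - x 1) * (x 0 - x 2) * (x 0 - x 3) * (x 0 - x 4)) -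
      x 1 ^ n / ((x 0 - x 1) * (x 1 - x 2) * (x 1 - x 3) * (x 1 - x 4)) +
      x 2 ^ n / ((x 0 - x 2) * (x 1 - x 2) * (x 2 - x 3) * (x 2 - x 4)) -
      x 3 ^ n / ((x 0 - x 3) * (x 1 - x 3) * (x 2 - x 3) * (x 3 - x 4)) +
      x 4 ^ n / ((x 0 - x 4) * (x 1 - x 4) * (x 2 - x 4) * (x 3 - x 4)) := by
  have h01 := h 0 1 (by norm_num) (by norm_num)
  have h02 := h 0 2 (by norm_num) (by norm_num)
  have h03 := h 0 3 (by norm_num) (by norm_num)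
  have h04 := h 0 4 (by norm_num) (by norm_num)
  have h12 := h 1 2 (by norm_num) (by norm_num)
  have h13 := h 1 3 (by norm_num) (by norm_num)
  have h14 := h 1 4 (by norm_num) (by norm_num)
  have h23 := h 2 3 (by norm_num) (by norm_num)
  have h24 := h 2 4 (by norm_num) (by norm_num)
  have h34 := h 3 4 (by norm_num) (by norm_num)
  have hd : ∀ r, r < 4 → ∀ i ∈ Finset.range (r + 1), x i - x (r + 1) ≠ 0 := fun r hr i hi =>
    h i (r + 1) (Finset.mem_range.1 hi) hr
  have e0 : ∀ n, homogeneousSum x n 0 = ∑ i ∈ Finset.range (0 + 1), (1 : R) * x i ^ n := by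
    intro n
    induction n with
    | zero => simp [homogeneousSum]
    | succ n ih =>
      rw [homogeneousSum, ih]
      simp [pow_succ']
  have e1 : ∀ n, homogeneousSum x n 1 = ∑ i ∈ Finset.range (1 + 1),
      ((fun | 0 => 1 / (x 0 - x 1) | _ => -1 / (x 0 - x 1) : ℕ → R)) i * x i ^ n := by
    intro n
    rw [homogeneousSum_succ_eq x 0 _ e0 (hd 0 (by norm_num))]
    simp only [Finset.sum_range_succ, Finset.sum_range_zero]
    ring
  have e2 : ∀ n, homogeneousSum x n 2 = ∑ i ∈ Finset.range (2 + 1),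
      ((fun | 0 => 1 / ((x 0 - x 1) * (x 0 - x 2)) | 1 => -1 / ((x 0 - x 1) * (x 1 - x 2))
            | _ => 1 / ((x 0 - x 2) * (x 1 - x 2)) : ℕ → R)) i * x i ^ n := by
    intro n
    rw [homogeneousSum_succ_eq x 1 _ e1 (hd 1 (by norm_num))]
    simp only [Finset.sum_range_succ, Finset.sum_range_zero]
    field_simp
    ring
  have e3 : ∀ n, homogeneousSum x n 3 = ∑ i ∈ Finset.range (3 + 1),
      ((fun | 0 => 1 / ((x 0 - x 1) * (x 0 - x 2) * (x 0 - x 3))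
            | 1 => -1 / ((x 0 - x 1) * (x 1 - x 2) * (x 1 - x 3))
            | 2 => 1 / ((x 0 - x 2) * (x 1 - x 2) * (x 2 - x 3))
            | _ => -1 / ((x 0 - x 3) * (x 1 - x 3) * (x 2 - x 3)) : ℕ → R)) i * x i ^ n := by
    intro n
    rw [homogeneousSum_succ_eq x 2 _ e2 (hd 2 (by norm_num))]
    simp only [Finset.sum_range_succ, Finset.sum_range_zero]
    field_simp
    ring
  rw [homogeneousSum_succ_eq x 3 _ e3 (hd 3 (by norm_num))]
  simp only [Finset.sum_range_succ, Finset.sum_range_zero]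
  field_simp
  ring

theorem cast_homogeneousSum {R : Type*} [CommRing R] (d : ℕ → ℤ) (n r : ℕ) :
    ((homogeneousSum d n r : ℤ) : R) = homogeneousSum (fun j => (d j : R)) n r := by
  induction n generalizing r with
  | zero => cases r <;> simp [homogeneousSum]
  | succ n ih => cases r <;> simp [homogeneousSum, ih]

theorem cast_keyValue (n k b c d e : ℕ) (h1 : 1 < b) (h2 : b < c) (h3 : c < d) (h4 : d < e)
    (he : e < 17) (s : ℕ) (hs : s < 2)
    (hk : k = 2 * (((b * 17 + c) * 17 + d) * 17 + e) + s) :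
    (keyValue n k : ℚ) = (-1) ^ s * (
      1 ^ n / ((1 - b) * (1 - c) * (1 - d) * (1 - e)) -
      b ^ n / ((1 - b) * (b - c) * (b - d) * (b - e)) +
      c ^ n / ((1 - c) * (b - c) * (c - d) * (c - e)) -
      d ^ n / ((1 - d) * (b - d) * (c - d) * (d - e)) +
      e ^ n / ((1 - e) * (b - e) * (c - e) * (d - e))) := by
  have hk2 : k / 2 = ((b * 17 + c) * 17 + d) * 17 + e := by omega
  have c0 : keyCounts (k / 2) 0 = 1 := rfl
  have c1 : keyCounts (k / 2) 1 = b := by rw [keyCounts]; congr 1; omega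
  have c2 : keyCounts (k / 2) 2 = c := by rw [keyCounts]; congr 1; omega
  have c3 : keyCounts (k / 2) 3 = d := by rw [keyCounts]; congr 1; omega
  have c4 : keyCounts (k / 2) 4 = e := by
    change ((k / 2 % 17 : ℕ) : ℤ) = e
    congr 1; omega
  have hsign : (if k % 2 = 0 then 1 else -1 : ℤ) = (-1) ^ s := by
    have hks : k % 2 = s := by omega
    rw [hks]
    interval_cases s <;> rfl
  have hmono : ∀ i < 4, keyCounts (k / 2) i < keyCounts (k / 2) (i + 1) := by
    intro i hi
    interval_cases i
    · rw [c1, keyCounts]; omega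
    · rw [c1, c2]; omega
    · rw [c2, c3]; omega
    · rw [c3, c4]; omega
  have hlt : ∀ i j, i < j → j ≤ 4 → keyCounts (k / 2) i < keyCounts (k / 2) j := by
    intro i j hij
    induction j, hij using Nat.le_induction with
    | base => exact fun h => hmono i h
    | succ j _ ih => exact fun h => (ih (by omega)).trans (hmono j h)
  rw [keyValue, hsign, Int.cast_mul, cast_homogeneousSum, homogeneousSum_four_eq]
  · simp only [c0, c1, c2, c3, c4, Int.cast_pow, Int.cast_neg, Int.cast_one, Int.cast_natCast]
  · intro i j hij hj
    rw [sub_ne_zero]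
    exact_mod_cast (hlt i j hij hj).ne

end ClosedForm

/-! ### The table of multiplicities and the final summation. -/

-- For instance `21532 = 2 * (((2 * 17 + 3) * 17 + 4) * 17 + 5)`: the arguments `(d_1, …, d_4) = (2,
-- 3, 4, 5)` occur 224 times with sign plus, and the odd key 21533 counts them with sign minus.
set_option maxRecDepth 100000 in
theorem spanningTally_eq : spanningTally =
    [(21532, 224), (21533, 258), (21534, 348), (21535, 322), (21536, 375), (21537, 234),
     (21538, 120), (21539, 412), (21540, 105), (21541, 20), (21542, 168), (21543, 18),
     (21547, 144), (21554, 60), (21568, 179), (21569, 161), (21570, 339), (21571, 186),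
     (21573, 432), (21574, 252), (21575, 72), (21576, 315), (21581, 189), (21604, 73),
     (21605, 58), (21606, 90), (21607, 291), (21608, 252), (21610, 252), (21611, 72),
     (21615, 486), (21622, 150), (21677, 5), (21678, 35), (21683, 90), (21690, 100),
     (22146, 63), (22147, 57), (22148, 114), (22149, 63), (22151, 144), (22152, 84),
     (22153, 24), (22154, 105), (22159, 63), (22182, 78), (22183, 63), (22184, 90),
     (22185, 291), (22186, 252), (22188, 252), (22189, 72), (22193, 486), (22200, 150),
     (22255, 24), (22256, 168), (22261, 432), (22268, 480)] := by
  decide +kernel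

theorem cast_evalTally_cons (n k m : ℕ) (t : Tally) :
    (evalTally (keyValue n) ((k, m) :: t) : ℚ) = m * keyValue n k + evalTally (keyValue n) t := by
  rw [evalTally_cons]
  push_cast
  rfl

theorem theorem1p4 (𝕜 : Type*) [RCLike 𝕜] (n : ℕ) :
    (resonanceBetti 𝕜 n 4 : ℚ) =
      (1 / 48 : ℚ) * (2 * 16 ^ n - 18 * 12 ^ n + 31 * 10 ^ n + 33 * 9 ^ n - 119 * 8 ^ n
        + 77 * 7 ^ n + 77 * 6 ^ n - 173 * 5 ^ n + 155 * 4 ^ n - 113 * 3 ^ n + 64 * 2 ^ n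
        - 16) := by
  rw [resonanceBetti_eq_sum, sum_families_eq_sum_spanning_families,
    sum_spanning_families_eq_evalTally, spanningTally_eq]
  -- The first count is always 2: some member of a spanning family contains the last coordinate, so
  -- a form in it alone has coefficient 0 or 1. The remaining inequalities are checked for each key
  -- of the table.
  have hkey : ∀ k, 2 < k / 2 / 289 % 17 → k / 2 / 289 % 17 < k / 2 / 17 % 17 →
      k / 2 / 17 % 17 < k / 2 % 17 → k / 2 / 4913 = 2 → _ := fun k h1 h2 h3 h4 =>
    cast_keyValue n k 2 (k / 2 / 289 % 17) (k / 2 / 17 % 17) (k / 2 % 17) (by norm_num) h1 h2 h3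
      (Nat.mod_lt _ (by norm_num)) (k % 2) (Nat.mod_lt _ (by norm_num)) (by omega)
  simp only [cast_evalTally_cons]
  simp (disch := norm_num) only [hkey]
  norm_num [evalTally]
  ring
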